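/- Let $G=(V,E,w)$ be a simple graph with $V=\{1,\dots,n\}$ and positive edge weights $w:E\to\mathbb R_{>0}$. Write $W(G)=\sum_{e\in E}w_e$ and let $M(G)$ be the maximum total weight of a matching of $G$. Let $A(G)$ be the weighted adjacency matrix, $D(G)$ the diagonal matrix of weighted degrees, $L(G)=D(G)-A(G)$ and $Q(G)=D(G)+A(G)$. The $k$-th token graph $F_k(G)$ has the $k$-element subsets of $V$ as vertices; $S,T$ are adjacent iff $S\triangle T=\{a,b\}$ with $a\in S$, $b\in T$, $ab\in E$, and then the edge $ST$ has weight $w_{ab}$. With $X_i,Y_i,Z_i$ the Pauli matrices acting on qubit $i$, define the $n$-qubit Hamiltonians $$H^{QMC}(G)=\sum_{ij\in E}\tfrac{w_{ij}}2(I-X_iX_j-Y_iY_j-Z_iZ_j),\quad H^{XY}(G)=\sum_{ij\in E}\tfrac{w_{ij}}2(I-X_iX_j-Y_iY_j),$$ $$H^{EPR}(G)=\sum_{ij\in E}\tfrac{w_{ij}}2(I+X_iX_j-Y_iY_j+Z_iZ_j).$$ Consider the following four conjectures, each asserted for all $n$, all unweighted graphs $G'$ (all edge weights equal to $1$) on $n$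 vertices with $m$ edges, and all integers $1\le k\le\lfloor n/2\rfloor$: (L-max) $\lambda_{\max}(L(F_k(G')))\le m+k$; (Q-max) $\lambda_{\max}(Q(F_k(G')))\le m+k$; (A-max) $\lambda_{\max}(A(F_k(G')))\le\frac12(m+k)$; (A-min) $\lambda_{\min}(A(F_k(G')))\ge-\frac12(m+k)$. **Lemma.** For every weighted graph $G$ as above: 1. (L-max) implies $\lambda_{\max}(H^{QMC}(G))\le W(G)+M(G)$; 2. (Q-max) implies $\lambda_{\max}(H^{EPR}(G))\le W(G)+M(G)$; 3. (A-min) implies $\lambda_{\max}(H^{XY}(G))\le W(G)+\frac{M(G)}2$; 4. (A-max) implies $\lambda_{\min}(H^{XY}(G))\ge-\frac{M(G)}2$. -/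

import Mathlib

open scoped BigOperators symmDiff

noncomputable section

/-- A weighted simple graph: a simple graph with a positive real weight on every edge.
The weight function is extended by `0` to the pairs that are not edges. -/
structure WGraph (V : Type*) where
  graph : SimpleGraph V
  weight : Sym2 V → ℝ
  weight_pos : ∀ e ∈ graph.edgeSet, 0 < weight e
  weight_zero : ∀ e, e ∉ graph.edgeSet → weight e = 0

namespace WGraph

open Classical in
/-- An unweighted graph, seen as a weighted graph all of whose edge weights are `1`. -/
def ofSimple {V : Type*} (G : SimpleGraph V) : WGraph V where
  graph := G
  weight e := if e ∈ G.edgeSet then 1 else 0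
  weight_pos e he := by simp [he]
  weight_zero e he := by simp [he]

section Basic

variable {V : Type*} [DecidableEq V]

/-- A matching: a set of edges such that every vertex is incident to at most one of them. -/
def IsMatching (G : WGraph V) (R : Finset (Sym2 V)) : Prop :=
  (∀ e ∈ R, e ∈ G.graph.edgeSet) ∧ ∀ v : V, (R.filter (fun e => v ∈ e)).card ≤ 1

theorem isMatching_empty (G : WGraph V) : G.IsMatching ∅ := by
  simp [IsMatching]

variable [Fintype V]

open Classical in
/-- The total edge weight `W(G)`. -/
def totalWeight (G : WGraph V) : ℝ := ∑ e ∈ G.graph.edgeFinset, G.weight e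

open Classical in
/-- The maximum weight `M(G)` of a matching of `G`. -/
def maxMatching (G : WGraph V) : ℝ :=
  (Finset.univ.filter (fun R : Finset (Sym2 V) => G.IsMatching R)).sup'
    ⟨∅, Finset.mem_filter.mpr ⟨Finset.mem_univ _, G.isMatching_empty⟩⟩
    (fun R => ∑ e ∈ R, G.weight e)

/-- The weighted adjacency matrix `A(G)`. -/
def adjMat (G : WGraph V) : Matrix V V ℝ := Matrix.of fun u v => G.weight s(u, v)

/-- The diagonal matrix `D(G)` of weighted degrees. -/
def degMat (G : WGraph V) : Matrix V V ℝ := Matrix.diagonal fun u => ∑ v, G.weight s(u, v)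

/-- The Laplacian matrix `L(G) = D(G) - A(G)`. -/
def lapMat (G : WGraph V) : Matrix V V ℝ := G.degMat - G.adjMat

/-- The signless Laplacian matrix `Q(G) = D(G) + A(G)`. -/
def signlessLapMat (G : WGraph V) : Matrix V V ℝ := G.degMat + G.adjMat

end Basic

section Token

variable {V : Type*} [DecidableEq V]

/-- The vertices of the `k`-th token graph: the `k`-element subsets of `V`. -/
abbrev Token (V : Type*) (k : ℕ) : Type _ := {A : Finset V // A.card = k}

/-- Adjacency in the token graph: the symmetric difference of `A` and `B` is a pair `{a, b}` with
`a ∈ A`, `b ∈ B` and `ab` an edge of `G`. -/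
def TokenAdj (G : WGraph V) (A B : Finset V) : Prop :=
  ∃ a ∈ A, ∃ b ∈ B, A ∆ B = {a, b} ∧ G.graph.Adj a b

/-- The weight of the pair `A`, `B`: it is `w_{ab}` if `A ∆ B = {a, b}` with `a ∈ A`, `b ∈ B`
(there is at most one nonzero term, see `tokenWeight_eq`), and `0` if there are no such `a`, `b`. -/
def tokenWeight (G : WGraph V) (A B : Finset V) : ℝ :=
  ∑ a ∈ A, ∑ b ∈ B, if A ∆ B = {a, b} then G.weight s(a, b) else 0

theorem tokenAdj_symm (G : WGraph V) {A B : Finset V} (h : G.TokenAdj A B) : G.TokenAdj B A := by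
  obtain ⟨a, ha, b, hb, hd, hab⟩ := h
  exact ⟨b, hb, a, ha, by rw [symmDiff_comm, hd, Finset.pair_comm], hab.symm⟩

theorem tokenWeight_comm (G : WGraph V) (A B : Finset V) :
    G.tokenWeight A B = G.tokenWeight B A := by
  unfold tokenWeight
  rw [Finset.sum_comm]
  refine Finset.sum_congr rfl fun b _ => Finset.sum_congr rfl fun a _ => ?_
  rw [symmDiff_comm, Finset.pair_comm, Sym2.eq_swap]

theorem tokenWeight_eq (G : WGraph V) {A B : Finset V} {a b : V} (ha : a ∈ A) (hb : b ∈ B)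
    (hd : A ∆ B = {a, b}) : G.tokenWeight A B = G.weight s(a, b) := by
  have haB : a ∉ B := by
    have : a ∈ A ∆ B := by simp [hd]
    rw [Finset.mem_symmDiff] at this
    tauto
  have hbA : b ∉ A := by
    have : b ∈ A ∆ B := by simp [hd]
    rw [Finset.mem_symmDiff] at this
    tauto
  have key : ∀ x ∈ A, ∀ y ∈ B, ({a, b} : Finset V) = {x, y} → x = a ∧ y = b := by
    intro x hx y hy h
    have h1 : x ∈ ({a, b} : Finset V) := by simp [h]
    have h2 : y ∈ ({a, b} : Finset V) := by simp [h]
    simp only [Finset.mem_insert, Finset.mem_singleton] at h1 h2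
    refine ⟨h1.resolve_right ?_, h2.resolve_left ?_⟩
    · rintro rfl; exact hbA hx
    · rintro rfl; exact haB hy
  unfold tokenWeight
  rw [hd, Finset.sum_eq_single_of_mem a ha, Finset.sum_eq_single_of_mem b hb]
  · simp
  · intro y hy hne
    exact if_neg fun h => hne (key a ha y hy h).2
  · intro x hx hne
    exact Finset.sum_eq_zero fun y hy => if_neg fun h => hne (key x hx y hy h).1

/-- The `k`-th token graph `F_k(G)` of a weighted graph. -/
def tokenGraph (G : WGraph V) (k : ℕ) : WGraph (Token V k) where
  graph :=
    { Adj := fun A B => G.TokenAdj A.1 B.1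
      symm := ⟨fun _ _ h => G.tokenAdj_symm h⟩
      loopless := ⟨fun A h => by
        obtain ⟨a, _, b, _, hd, _⟩ := h
        have : a ∈ A.1 ∆ A.1 := by rw [hd]; simp
        simp at this⟩ }
  weight := Sym2.lift ⟨fun A B => G.tokenWeight A.1 B.1, fun A B => G.tokenWeight_comm A.1 B.1⟩
  weight_pos := by
    intro e
    induction e using Sym2.ind with
    | _ A B =>
      intro h
      obtain ⟨a, ha, b, hb, hd, hab⟩ := h
      rw [Sym2.lift_mk]
      change 0 < G.tokenWeight A.1 B.1
      rw [G.tokenWeight_eq ha hb hd]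
      exact G.weight_pos _ hab
  weight_zero := by
    intro e
    induction e using Sym2.ind with
    | _ A B =>
      intro h
      rw [Sym2.lift_mk]
      refine Finset.sum_eq_zero fun a ha => Finset.sum_eq_zero fun b hb => ?_
      split_ifs with hd
      · exact G.weight_zero _ fun hab => h ⟨a, ha, b, hb, hd, hab⟩
      · rfl

end Token

end WGraph

section Eigenvalues

variable {𝕜 ι : Type*} [RCLike 𝕜] [Fintype ι] [DecidableEq ι]

/-- The largest eigenvalue of a Hermitian matrix (the spectrum is a finite set). -/
def lamMax (A : Matrix ι ι 𝕜) : ℝ := sSup (spectrum ℝ A)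

/-- The smallest eigenvalue of a Hermitian matrix. -/
def lamMin (A : Matrix ι ι 𝕜) : ℝ := sInf (spectrum ℝ A)

end Eigenvalues

/-! The four conjectures on token graphs of unweighted graphs. -/

/-- `λ_max(L(F_k(G))) ≤ m + k` for all unweighted graphs and all `1 ≤ k ≤ ⌊n/2⌋`. -/
def ConjLMax : Prop :=
  ∀ (n : ℕ) (G : SimpleGraph (Fin n)) (k : ℕ), 1 ≤ k → k ≤ n / 2 →
    lamMax ((WGraph.ofSimple G).tokenGraph k).lapMat ≤ (G.edgeSet.ncard : ℝ) + (k : ℝ)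

/-- `λ_max(Q(F_k(G))) ≤ m + k` for all unweighted graphs and all `1 ≤ k ≤ ⌊n/2⌋`. -/
def ConjQMax : Prop :=
  ∀ (n : ℕ) (G : SimpleGraph (Fin n)) (k : ℕ), 1 ≤ k → k ≤ n / 2 →
    lamMax ((WGraph.ofSimple G).tokenGraph k).signlessLapMat ≤ (G.edgeSet.ncard : ℝ) + (k : ℝ)

/-- `λ_max(A(F_k(G))) ≤ (m + k)/2` for all unweighted graphs and all `1 ≤ k ≤ ⌊n/2⌋`. -/
def ConjAMax : Prop :=
  ∀ (n : ℕ) (G : SimpleGraph (Fin n)) (k : ℕ), 1 ≤ k → k ≤ n / 2 →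
    lamMax ((WGraph.ofSimple G).tokenGraph k).adjMat ≤ (1 / 2 : ℝ) * ((G.edgeSet.ncard : ℝ) + (k : ℝ))

/-- `λ_min(A(F_k(G))) ≥ -(m + k)/2` for all unweighted graphs and all `1 ≤ k ≤ ⌊n/2⌋`. -/
def ConjAMin : Prop :=
  ∀ (n : ℕ) (G : SimpleGraph (Fin n)) (k : ℕ), 1 ≤ k → k ≤ n / 2 →
    lamMin ((WGraph.ofSimple G).tokenGraph k).adjMat ≥
      -((1 / 2 : ℝ) * ((G.edgeSet.ncard : ℝ) + (k : ℝ)))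

/-! Qubit Hamiltonians, as matrices in the computational basis `V → Fin 2`. -/

/-- The Pauli matrices. -/
def pauliX : Matrix (Fin 2) (Fin 2) ℂ := !![0, 1; 1, 0]

def pauliY : Matrix (Fin 2) (Fin 2) ℂ := !![0, -Complex.I; Complex.I, 0]

def pauliZ : Matrix (Fin 2) (Fin 2) ℂ := !![1, 0; 0, -1]

section Hamiltonians

variable {V : Type*} [Fintype V] [DecidableEq V]

/-- The tensor product `⊗_v P_v` of one-qubit operators. -/
def tensorOp (P : V → Matrix (Fin 2) (Fin 2) ℂ) : Matrix (V → Fin 2) (V → Fin 2) ℂ :=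
  Matrix.of fun x y => ∏ v, P v (x v) (y v)

/-- The operator `P_i P_j`, for the edge `e = ij`: `P` on both endpoints of `e`, tensored with the
identity on all the other qubits. -/
def edgeOp (P : Matrix (Fin 2) (Fin 2) ℂ) (e : Sym2 V) : Matrix (V → Fin 2) (V → Fin 2) ℂ :=
  tensorOp fun v => if v ∈ e then P else 1

/-- `h^{QMC}_{ij} = (I - X_i X_j - Y_i Y_j - Z_i Z_j) / 2`. -/
def termQMC (e : Sym2 V) : Matrix (V → Fin 2) (V → Fin 2) ℂ :=
  (1 / 2 : ℂ) • (1 - edgeOp pauliX e - edgeOp pauliY e - edgeOp pauliZ e)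

/-- `h^{XY}_{ij} = (I - X_i X_j - Y_i Y_j) / 2`. -/
def termXY (e : Sym2 V) : Matrix (V → Fin 2) (V → Fin 2) ℂ :=
  (1 / 2 : ℂ) • (1 - edgeOp pauliX e - edgeOp pauliY e)

/-- `h^{EPR}_{ij} = (I + X_i X_j - Y_i Y_j + Z_i Z_j) / 2`. -/
def termEPR (e : Sym2 V) : Matrix (V → Fin 2) (V → Fin 2) ℂ :=
  (1 / 2 : ℂ) • (1 + edgeOp pauliX e - edgeOp pauliY e + edgeOp pauliZ e)

namespace WGraph

open Classical in
/-- The Hamiltonian `H(G) = ∑_{ij ∈ E} w_{ij} h_{ij}`. -/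
def hamiltonian (h : Sym2 V → Matrix (V → Fin 2) (V → Fin 2) ℂ) (G : WGraph V) :
    Matrix (V → Fin 2) (V → Fin 2) ℂ :=
  ∑ e ∈ G.graph.edgeFinset, (G.weight e : ℂ) • h e

/-- The Quantum MaxCut Hamiltonian. -/
def HQMC (G : WGraph V) : Matrix (V → Fin 2) (V → Fin 2) ℂ := G.hamiltonian termQMC

/-- The XY Hamiltonian. -/
def HXY (G : WGraph V) : Matrix (V → Fin 2) (V → Fin 2) ℂ := G.hamiltonian termXY

/-- The EPR Hamiltonian. -/
def HEPR (G : WGraph V) : Matrix (V → Fin 2) (V → Fin 2) ℂ := G.hamiltonian termEPR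

end WGraph

end Hamiltonians

end

/-! ### An induction principle for maximum weight matchings -/

/-! Identify a computational basis state with the set of vertices whose qubit is 1. In this basis
every edge term acts as α + βD + γA, where D and A are the degree and adjacency parts of the
disjoint union of all token graphs `F_k`, 0 ≤ k ≤ n. The triple (α, β, γ) is (0, 1, -1) for QMC,
(1/2, 0, -1) for XY, and (0, 1, 1) for EPR after a rotation of every qubit about the X axis. All
four claims thus reduce to one inequality (`TokenBound.form_weight_le`): the quadratic form βD + γA
is at most (1 + β)/2 · (W + M) times the squared norm. The lower bound for XY uses it with γ = 1 and
a change of sign.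

Bounds of the shape (1 + β)/2 · (W + a) add up when weights are added. Two kinds of unweighted
pieces are available: a star has such a bound with a = 1, unconditionally (`bound_star`), and a
graph on a vertex set C has one with a = ⌊|C|/2⌋ by the conjecture (`TokenBound.bound_clique`). It
remains to split integer weights into such pieces so that the values of a add up to at most the
weight of one matching.

This is the integral duality for the matching polytope (Edmonds, Cunningham–Marsh), proved in
`exists_matching_bound` by induction on the total weight. If some vertex is covered by every maximum
weight matching, its star is peeled off. Otherwise one unit is removed from every edge of a
component C of the support, and an exchange argument in the style of Gallai's lemma shows that a
matching optimal for the reduced weights, with ties broken by the original weights, misses at most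
one vertex of C. Real weights follow by scaling and rounding down. -/

namespace MatchingInduction

variable {V : Type*}

/-- A set of pairwise disjoint pairs of positive weight. -/
def IsMatchingIn (w : Sym2 V → ℕ) (R : Finset (Sym2 V)) : Prop :=
  (∀ e ∈ R, 0 < w e) ∧ ∀ e ∈ R, ∀ f ∈ R, ∀ v, v ∈ e → v ∈ f → e = f

theorem isMatchingIn_empty (w : Sym2 V → ℕ) : IsMatchingIn w ∅ := by
  simp [IsMatchingIn]

theorem IsMatchingIn.mono {w w' : Sym2 V → ℕ} {R : Finset (Sym2 V)} (hR : IsMatchingIn w R)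
    (h : ∀ e, w e ≤ w' e) : IsMatchingIn w' R :=
  ⟨fun e he => (hR.1 e he).trans_le (h e), hR.2⟩

variable [DecidableEq V]

/-- No edge of `R` contains `v`. -/
def Misses (R : Finset (Sym2 V)) (v : V) : Prop := ∀ e ∈ R, v ∉ e

/-- Every edge of `R` that meets `X` lies inside `X`. -/
def ClosedUnder (R : Finset (Sym2 V)) (X : Finset V) : Prop :=
  ∀ e ∈ R, ∀ v ∈ e, v ∈ X → e.toFinset ⊆ X

/-- The edges of `R` inside `X`. -/
def edgesIn (R : Finset (Sym2 V)) (X : Finset V) : Finset (Sym2 V) :=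
  R.filter fun e => e.toFinset ⊆ X

theorem IsMatchingIn.insert {w : Sym2 V → ℕ} {R : Finset (Sym2 V)} (hR : IsMatchingIn w R)
    {u v : V} (hw : 0 < w s(u, v)) (hu : Misses R u) (hv : Misses R v) :
    IsMatchingIn w (insert s(u, v) R) := by
  refine ⟨?_, ?_⟩
  · intro e he
    rcases Finset.mem_insert.1 he with rfl | he
    · exact hw
    · exact hR.1 e he
  · intro e he f hf x hxe hxf
    rcases Finset.mem_insert.1 he with he' | he' <;> rcases Finset.mem_insert.1 hf with hf' | hf'
    · rw [he', hf']
    · subst he'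
      rcases Sym2.mem_iff.1 hxe with rfl | rfl
      · exact absurd hxf (hu f hf')
      · exact absurd hxf (hv f hf')
    · subst hf'
      rcases Sym2.mem_iff.1 hxf with rfl | rfl
      · exact absurd hxe (hu e he')
      · exact absurd hxe (hv e he')
    · exact hR.2 e he' f hf' x hxe hxf

-- A vertex of X is either missed or covered by exactly one edge of R. By closedness that edge lies
-- inside X, and it has two distinct ends.
open Classical in
theorem two_mul_card_edgesIn {w : Sym2 V → ℕ} (hw : ∀ e, e.IsDiag → w e = 0)
    {R : Finset (Sym2 V)} (hR : IsMatchingIn w R) {X : Finset V} (hX : ClosedUnder R X) :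
    2 * (edgesIn R X).card + (X.filter (Misses R)).card = X.card := by
  have h1 : X.filter (fun v => ¬ Misses R v) = (edgesIn R X).biUnion Sym2.toFinset := by
    ext v
    simp only [Finset.mem_filter, Finset.mem_biUnion, edgesIn, Sym2.mem_toFinset]
    constructor
    · rintro ⟨hv, h⟩
      unfold Misses at h
      push Not at h
      obtain ⟨e, he, hve⟩ := h
      exact ⟨e, ⟨he, hX e he v hve hv⟩, hve⟩
    · rintro ⟨e, ⟨he, heX⟩, hve⟩
      exact ⟨heX (Sym2.mem_toFinset.2 hve), fun h => h e he hve⟩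
  have h2 : ((edgesIn R X).biUnion Sym2.toFinset).card = 2 * (edgesIn R X).card := by
    rw [Finset.card_biUnion, Finset.sum_congr rfl (g := fun _ => 2)]
    · simp [mul_comm]
    · intro e he
      refine Sym2.card_toFinset_of_not_isDiag e fun hd => ?_
      have := hR.1 e (Finset.mem_filter.1 he).1
      rw [hw e hd] at this
      exact this.false
    · intro e he f hf hne
      refine Finset.disjoint_left.2 fun v hve hvf => hne ?_
      exact hR.2 e (Finset.mem_filter.1 he).1 f (Finset.mem_filter.1 hf).1 v
        (Sym2.mem_toFinset.1 hve) (Sym2.mem_toFinset.1 hvf)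
  rw [← h2, ← h1, add_comm]
  exact Finset.card_filter_add_card_filter_not _

/-- Exchange `M` for `N` inside `X`. -/
def swap (M N : Finset (Sym2 V)) (X : Finset V) : Finset (Sym2 V) :=
  (M.filter fun e => ¬ e.toFinset ⊆ X) ∪ edgesIn N X

theorem mem_swap {M N : Finset (Sym2 V)} {X : Finset V} {e : Sym2 V} :
    e ∈ swap M N X ↔ (e ∈ M ∧ ¬ e.toFinset ⊆ X) ∨ (e ∈ N ∧ e.toFinset ⊆ X) := by
  simp [swap, edgesIn]

theorem sum_swap (M N : Finset (Sym2 V)) (X : Finset V) (h : Sym2 V → ℕ) :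
    ∑ e ∈ swap M N X, h e + ∑ e ∈ edgesIn M X, h e = ∑ e ∈ M, h e + ∑ e ∈ edgesIn N X, h e := by
  rw [swap, Finset.sum_union, ← Finset.sum_filter_add_sum_filter_not M (fun e => e.toFinset ⊆ X) h]
  · simp only [edgesIn]; ring
  · refine Finset.disjoint_left.2 fun e he hf => ?_
    exact (Finset.mem_filter.1 he).2 (Finset.mem_filter.1 hf).2

theorem isMatchingIn_swap {w : Sym2 V → ℕ} {M N : Finset (Sym2 V)} (hM : IsMatchingIn w M)
    (hN : IsMatchingIn w N) {X : Finset V} (hX : ClosedUnder M X) :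
    IsMatchingIn w (swap M N X) := by
  refine ⟨?_, ?_⟩
  · intro e he
    rcases mem_swap.1 he with he | he
    exacts [hM.1 e he.1, hN.1 e he.1]
  · intro e he f hf v hve hvf
    rcases mem_swap.1 he with he | he <;> rcases mem_swap.1 hf with hf | hf
    · exact hM.2 e he.1 f hf.1 v hve hvf
    · exact absurd (hX e he.1 v hve (hf.2 (Sym2.mem_toFinset.2 hvf))) he.2
    · exact absurd (hX f hf.1 v hvf (he.2 (Sym2.mem_toFinset.2 hve))) hf.2
    · exact hN.2 e he.1 f hf.1 v hve hvf

theorem misses_swap_of_mem {M N : Finset (Sym2 V)} {X : Finset V} (hX : ClosedUnder M X) {v : V}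
    (hv : v ∈ X) (h : Misses N v) : Misses (swap M N X) v := by
  intro e he hve
  rcases mem_swap.1 he with he | he
  · exact he.2 (hX e he.1 v hve hv)
  · exact h e he.1 hve

theorem misses_swap_of_notMem {M N : Finset (Sym2 V)} {X : Finset V} {v : V}
    (hv : v ∉ X) (h : Misses M v) : Misses (swap M N X) v := by
  intro e he hve
  rcases mem_swap.1 he with he | he
  · exact h e he.1 hve
  · exact hv (he.2 (Sym2.mem_toFinset.2 hve))

/-! ### Lexicographically optimal matchings -/

section Reduction

variable {w w' : Sym2 V → ℕ}

/-- `M` is lexicographically optimal for `(w', w)` among the matchings of `w`. -/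
def LexOptimal (w w' : Sym2 V → ℕ) (M : Finset (Sym2 V)) : Prop :=
  IsMatchingIn w M ∧ ∀ R, IsMatchingIn w R → ∑ e ∈ M, w' e ≤ ∑ e ∈ R, w' e →
    ∑ e ∈ R, w' e = ∑ e ∈ M, w' e ∧ ∑ e ∈ R, w e ≤ ∑ e ∈ M, w e

/-- The weights `w` and `w'` differ by one on the edges inside `C`. -/
def ReducedOn (w w' : Sym2 V → ℕ) (C : Finset V) : Prop :=
  ∀ e, w e = w' e + if 0 < w e ∧ e.toFinset ⊆ C then 1 else 0

theorem ReducedOn.sum_eq {C : Finset V} (h : ReducedOn w w' C) {R : Finset (Sym2 V)}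
    (hR : IsMatchingIn w R) : ∑ e ∈ R, w e = ∑ e ∈ R, w' e + (edgesIn R C).card := by
  rw [Finset.sum_congr rfl fun e _ => h e, Finset.sum_add_distrib, edgesIn, Finset.card_filter]
  congr 1
  refine Finset.sum_congr rfl fun e he => ?_
  simp [hR.1 e he]

/-- Adding the edge would not lower the `w'`-weight and would strictly raise the `w`-weight. The
second coordinate of the order decides the case where `w'` vanishes on the edge. -/
theorem LexOptimal.not_misses_edge {M : Finset (Sym2 V)} (hM : LexOptimal w w' M) {u v : V} (huv : 0 < w s(u, v))
    (hu : Misses M u) : ¬ Misses M v := by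
  intro hv
  have hnot : s(u, v) ∉ M := fun hm => hu _ hm (Sym2.mem_mk_left u v)
  have h1 := hM.2 _ (hM.1.insert huv hu hv)
  rw [Finset.sum_insert hnot, Finset.sum_insert hnot] at h1
  have := h1 (by omega)
  omega

end Reduction

theorem sub_indicator_add {w : Sym2 V → ℕ} {J : Finset (Sym2 V)} (hJ : ∀ e ∈ J, 0 < w e) :
    ((fun e => w e - if e ∈ J then 1 else 0) + fun e => if e ∈ J then 1 else 0) = w := by
  funext e
  by_cases he : e ∈ J
  · have := hJ e he
    simp only [Pi.add_apply, he, if_true]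
    omega
  · simp [he]

/-! ### Connected components of a set of pairs -/

variable [Fintype V]

open Classical in
/-- The vertices that can be reached from `t` along pairs in `S`. -/
noncomputable def component (S : Set (Sym2 V)) (t : V) : Finset V :=
  Finset.univ.filter fun v => (SimpleGraph.fromEdgeSet S).Reachable t v

theorem mem_component {S : Set (Sym2 V)} {t v : V} :
    v ∈ component S t ↔ (SimpleGraph.fromEdgeSet S).Reachable t v := by
  simp [component]

theorem self_mem_component (S : Set (Sym2 V)) (t : V) : t ∈ component S t :=
  mem_component.2 (SimpleGraph.Reachable.refl t)

theorem closedUnder_component {S : Set (Sym2 V)} {R : Finset (Sym2 V)} (h : ∀ e ∈ R, e ∈ S)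
    (t : V) : ClosedUnder R (component S t) := by
  intro e he v hve hv x hx
  have hx' := Sym2.mem_toFinset.1 hx
  rw [mem_component] at hv ⊢
  by_cases hvx : v = x
  · exact hvx ▸ hv
  · have : e = s(v, x) := ((Sym2.mem_and_mem_iff hvx).1 ⟨hve, hx'⟩)
    refine hv.trans (SimpleGraph.Adj.reachable ?_)
    rw [SimpleGraph.fromEdgeSet_adj]
    exact ⟨this ▸ h e he, hvx⟩

theorem component_subset {R : Finset (Sym2 V)} {C : Finset V} (hC : ClosedUnder R C) {t : V}
    (ht : t ∈ C) : component (R : Set (Sym2 V)) t ⊆ C := by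
  intro v hv
  obtain ⟨p⟩ := mem_component.1 hv
  induction p with
  | nil => exact ht
  | cons h p ih =>
    have h' := (SimpleGraph.fromEdgeSet_adj _).1 h
    have hb := hC _ h'.1 _ (Sym2.mem_mk_left _ _) ht (Sym2.mem_toFinset.2 (Sym2.mem_mk_right _ _))
    exact ih hb (mem_component.2 p.reachable)

/-- A connected graph on k vertices has at least k - 1 edges. Applied to the union of two matchings,
this limits how many vertices of a component they can miss. -/
theorem card_component_le (S : Finset (Sym2 V)) (t : V) :
    (component (S : Set (Sym2 V)) t).card ≤ (edgesIn S (component (S : Set (Sym2 V)) t)).card + 1 := by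
  classical
  set K := SimpleGraph.fromEdgeSet (S : Set (Sym2 V)) with hK
  set C := K.connectedComponentMk t with hC
  have hmem : ∀ v, v ∈ C.supp ↔ v ∈ component (S : Set (Sym2 V)) t := by
    intro v
    rw [mem_component, SimpleGraph.ConnectedComponent.mem_supp_iff, hC,
      SimpleGraph.ConnectedComponent.eq, SimpleGraph.reachable_comm]
  have h := C.connected_toSimpleGraph.card_vert_le_card_edgeSet_add_one
  have h1 : Nat.card C = (component (S : Set (Sym2 V)) t).card := by
    rw [← Nat.card_eq_finsetCard]
    exact Nat.card_congr (Equiv.subtypeEquivRight hmem)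
  have h2 : Nat.card C.toSimpleGraph.edgeSet ≤
      (edgesIn S (component (S : Set (Sym2 V)) t)).card := by
    rw [← Nat.card_eq_finsetCard]
    have hmaps : ∀ e ∈ C.toSimpleGraph.edgeSet,
        Sym2.map Subtype.val e ∈ edgesIn S (component (S : Set (Sym2 V)) t) := by
      intro e
      induction e using Sym2.ind with
      | _ a b =>
        intro hab
        have hab' : K.Adj a.1 b.1 := hab
        have hab'' := ((SimpleGraph.fromEdgeSet_adj _).1 hab').1
        refine Finset.mem_filter.2 ⟨hab'', fun v hv => ?_⟩
        rw [Sym2.mem_toFinset, Sym2.map_mk, Sym2.mem_iff] at hv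
        rcases hv with rfl | rfl
        exacts [(hmem _).1 a.2, (hmem _).1 b.2]
    refine Nat.card_le_card_of_injective
      (fun e : C.toSimpleGraph.edgeSet =>
        (⟨Sym2.map Subtype.val e.1, hmaps e.1 e.2⟩ :
          edgesIn S (component (S : Set (Sym2 V)) t))) fun e f hef => ?_
    exact Subtype.ext (Sym2.map.injective Subtype.val_injective (congrArg Subtype.val hef))
  omega

/-! ### Exchanging matchings on a component -/

section Exchange

variable {w w' : Sym2 V → ℕ}

theorem exists_lexOptimal {V : Type*} [Fintype V] (w w' : Sym2 V → ℕ) : ∃ M, LexOptimal w w' M := by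
  classical
  obtain ⟨M, hM, hmax⟩ := Finset.exists_max_image
    (Finset.univ.filter fun R => IsMatchingIn w R)
    (fun R => toLex (∑ e ∈ R, w' e, ∑ e ∈ R, w e)) ⟨∅, by simp [isMatchingIn_empty]⟩
  refine ⟨M, (Finset.mem_filter.1 hM).2, fun R hR hle => ?_⟩
  have h := hmax R (by simpa using hR)
  rw [Prod.Lex.le_iff] at h
  simp only [ofLex_toLex] at h
  omega

/-- The component of `M ∪ N` through a vertex missed by `N` contains at most one vertex
missed by `M`, and exchanging `M` for `N` there keeps `M` lexicographically optimal. -/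
theorem LexOptimal.exists_swap (hw : ∀ e, e.IsDiag → w e = 0) {C : Finset V}
    (h : ReducedOn w w' C) (hC : ∀ R, IsMatchingIn w R → ClosedUnder R C)
    {M N : Finset (Sym2 V)} (hM : LexOptimal w w' M) (hN : IsMatchingIn w N)
    (hNmax : ∀ R, IsMatchingIn w R → ∑ e ∈ R, w e ≤ ∑ e ∈ N, w e)
    {t u v : V} (ht : t ∈ C) (htN : Misses N t) (huv : u ≠ v)
    (hu : Misses M u) (hv : Misses M v) :
    ∃ M', LexOptimal w w' M' ∧ Misses M' t ∧ (Misses M' u ∨ Misses M' v) := by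
  classical
  set X := component ((M ∪ N : Finset (Sym2 V)) : Set (Sym2 V)) t with hX
  have hXM : ClosedUnder M X := closedUnder_component (fun e he => by simp [he]) t
  have hXN : ClosedUnder N X := closedUnder_component (fun e he => by simp [he]) t
  have htX : t ∈ X := self_mem_component _ t
  have hcard : X.card ≤ (edgesIn M X).card + (edgesIn N X).card + 1 := by
    refine (card_component_le (M ∪ N) t).trans ?_
    rw [edgesIn, Finset.filter_union]
    exact Nat.add_le_add_right (Finset.card_union_le _ _) 1
  have hM2 := two_mul_card_edgesIn hw hM.1 hXM
  have hN2 := two_mul_card_edgesIn hw hN hXN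
  have hNt : 1 ≤ (X.filter (Misses N)).card :=
    Finset.card_pos.2 ⟨t, Finset.mem_filter.2 ⟨htX, htN⟩⟩
  -- Let μ and ν count the vertices of X missed by `M` and `N`. Adding `hM2` and `hN2` and comparing
  -- with `hcard` gives μ + ν ≤ 2. Since t is counted in ν, μ ≤ 1.
  have hor : u ∉ X ∨ v ∉ X := by
    by_contra! hcon
    have : ({u, v} : Finset V).card ≤ (X.filter (Misses M)).card := by
      refine Finset.card_le_card fun x hx => ?_
      rcases Finset.mem_insert.1 hx with rfl | hx
      · exact Finset.mem_filter.2 ⟨hcon.1, hu⟩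
      · rw [Finset.mem_singleton.1 hx]
        exact Finset.mem_filter.2 ⟨hcon.2, hv⟩
    rw [Finset.card_pair huv] at this
    omega
  have hXC : X ⊆ C := by
    refine component_subset (fun e he => ?_) ht
    rcases Finset.mem_union.1 he with he | he
    exacts [hC M hM.1 e he, hC N hN e he]
  have hcount : ∀ R, IsMatchingIn w R → ∑ e ∈ edgesIn R X, w e =
      ∑ e ∈ edgesIn R X, w' e + (edgesIn R X).card := by
    intro R hR
    rw [Finset.sum_congr rfl fun e _ => h e, Finset.sum_add_distrib, Finset.card_eq_sum_ones]
    congr 1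
    refine Finset.sum_congr rfl fun e he => ?_
    have he' := Finset.mem_filter.1 he
    simp [hR.1 e he'.1, he'.2.trans hXC]
  have hM' := isMatchingIn_swap hM.1 hN hXM
  have hN' := isMatchingIn_swap hN hM.1 hXN
  -- Maximality of `N` says that, inside X, `N` has at least the `w`-weight of `M`. As μ ≤ 1 ≤ ν, it
  -- uses no more edges there, and each edge inside X accounts for exactly one unit of difference
  -- between `w` and `w'`. So the `w'`-weight does not drop either, and optimality of `M` makes both
  -- weights agree after the exchange.
  have e1 := sum_swap M N X w
  have e2 := sum_swap N M X w
  have e3 := sum_swap M N X w'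
  have e4 := hcount M hM.1
  have e5 := hcount N hN
  have e6 := hNmax _ hN'
  have e7 := hM.2 _ hM' (by omega)
  refine ⟨swap M N X, ⟨hM', fun R hR hle => ?_⟩, misses_swap_of_mem hXM htX htN,
    hor.imp (fun h => misses_swap_of_notMem h hu) (fun h => misses_swap_of_notMem h hv)⟩
  have := hM.2 R hR (by omega)
  omega

/-- Gallai's argument, by induction on the walk. Let t be the vertex after u. An exchange produces
an optimal matching that misses t and still misses u or v. The first is impossible because ut is an
edge, and the second contradicts the induction hypothesis for the walk from t to v. -/
theorem LexOptimal.not_misses_of_walk (hw : ∀ e, e.IsDiag → w e = 0) {C : Finset V}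
    (h : ReducedOn w w' C) (hC : ∀ R, IsMatchingIn w R → ClosedUnder R C)
    (hmiss : ∀ t ∈ C, ∃ N, IsMatchingIn w N ∧
      (∀ R, IsMatchingIn w R → ∑ e ∈ R, w e ≤ ∑ e ∈ N, w e) ∧ Misses N t)
    {u v : V} (p : (SimpleGraph.fromEdgeSet {e | 0 < w e}).Walk u v)
    (hp : ∀ x ∈ p.support, x ∈ C) (huv : u ≠ v) :
    ∀ {M}, LexOptimal w w' M → Misses M u → ¬ Misses M v := by
  induction p with
  | nil => exact absurd rfl huv
  | @cons u t v hut p ih =>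
    intro M hM hu hv
    have hut' : 0 < w s(u, t) := ((SimpleGraph.fromEdgeSet_adj _).1 hut).1
    have hpt : ∀ x ∈ p.support, x ∈ C := fun x hx => hp x (by simp [hx])
    by_cases htv : t = v
    · exact hM.not_misses_edge hut' hu (htv ▸ hv)
    have htC : t ∈ C := hpt t p.start_mem_support
    obtain ⟨N, hN, hNmax, htN⟩ := hmiss t htC
    obtain ⟨M', hM', ht', hu' | hv'⟩ := hM.exists_swap hw h hC hN hNmax htC htN huv hu hv
    · exact hM'.not_misses_edge hut' hu' ht'
    · exact ih hpt htv hM' ht' hv'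

end Exchange

/-! ### Peeling off stars and components -/

theorem sum_sub_indicator_lt {w : Sym2 V → ℕ} {J : Finset (Sym2 V)} (hJ : ∀ e ∈ J, 0 < w e)
    (hne : J.Nonempty) : ∑ e, (w e - if e ∈ J then 1 else 0) < ∑ e, w e := by
  obtain ⟨e, he⟩ := hne
  refine Finset.sum_lt_sum (fun e _ => Nat.sub_le _ _) ⟨e, Finset.mem_univ e, ?_⟩
  have := hJ e he
  simp [he, this]

/-- A bound `P w a` which is subadditive, holds with `a = 1` for stars and with `a = ⌊|C|/2⌋` for
graphs with vertex set `C`, holds for every integer weighted graph with `a` the weight of some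
matching. -/
theorem exists_matching_bound (P : (Sym2 V → ℕ) → ℕ → Prop) (zero : P 0 0)
    (add : ∀ w w' a a', P w a → P w' a' → P (w + w') (a + a'))
    (mono : ∀ w a a', a ≤ a' → P w a → P w a')
    (star : ∀ (u : V) (J : Finset (Sym2 V)), (∀ e ∈ J, ¬ e.IsDiag ∧ u ∈ e) →
      P (fun e => if e ∈ J then 1 else 0) 1)
    (clique : ∀ (C : Finset V) (J : Finset (Sym2 V)), (∀ e ∈ J, ¬ e.IsDiag ∧ e.toFinset ⊆ C) →
      P (fun e => if e ∈ J then 1 else 0) (C.card / 2))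
    (w : Sym2 V → ℕ) (hw : ∀ e, e.IsDiag → w e = 0) :
    ∃ R, IsMatchingIn w R ∧ P w (∑ e ∈ R, w e) := by
  classical
  induction hn : ∑ e, w e using Nat.strong_induction_on generalizing w with
  | _ n ih =>
  subst hn
  by_cases h0 : w = 0
  · subst h0
    exact ⟨∅, isMatchingIn_empty _, by simpa using zero⟩
  obtain ⟨e₀, he₀⟩ : ∃ e, 0 < w e := by
    by_contra! hcon
    exact h0 (funext fun e => Nat.le_zero.1 (hcon e))
  have hdiag : ∀ e, 0 < w e → ¬ e.IsDiag := fun e he hd => by simp [hw e hd] at he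
  have step : ∀ J : Finset (Sym2 V), (∀ e ∈ J, 0 < w e) → J.Nonempty →
      ∃ R, IsMatchingIn w R ∧ P (fun e => w e - if e ∈ J then 1 else 0)
        (∑ e ∈ R, (w e - if e ∈ J then 1 else 0)) := by
    intro J hJ hne
    obtain ⟨R, hR, hP⟩ := ih _ (sum_sub_indicator_lt hJ hne)
      (fun e => w e - if e ∈ J then 1 else 0) (fun e he => by simp [hw e he]) rfl
    exact ⟨R, hR.mono fun e => Nat.sub_le _ _, hP⟩
  by_cases hcov : ∃ u, ∀ N, IsMatchingIn w N →
      (∀ R, IsMatchingIn w R → ∑ e ∈ R, w e ≤ ∑ e ∈ N, w e) → ¬ Misses N u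
  · obtain ⟨u, hu⟩ := hcov
    obtain ⟨N, hN, hNmax⟩ : ∃ N, IsMatchingIn w N ∧
        ∀ R, IsMatchingIn w R → ∑ e ∈ R, w e ≤ ∑ e ∈ N, w e := by
      obtain ⟨N, hN, hmax⟩ := Finset.exists_max_image (Finset.univ.filter (IsMatchingIn w))
        (fun R => ∑ e ∈ R, w e) ⟨∅, by simp [isMatchingIn_empty]⟩
      exact ⟨N, (Finset.mem_filter.1 hN).2, fun R hR => hmax R (by simpa using hR)⟩
    set J := Finset.univ.filter fun e => 0 < w e ∧ u ∈ e with hJ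
    have hJpos : ∀ e ∈ J, 0 < w e := fun e he => (Finset.mem_filter.1 he).2.1
    have hJne : J.Nonempty := by
      have := hu N hN hNmax
      unfold Misses at this
      push Not at this
      obtain ⟨e, he, hue⟩ := this
      exact ⟨e, Finset.mem_filter.2 ⟨Finset.mem_univ e, hN.1 e he, hue⟩⟩
    obtain ⟨R, hR, hP⟩ := step J hJpos hJne
    have hPw := add _ _ _ _ hP (star u J fun e he => ⟨hdiag e (hJpos e he),
      (Finset.mem_filter.1 he).2.2⟩)
    rw [sub_indicator_add hJpos] at hPw
    -- Peeling the star costs one unit, which some matching must regain. If `R` misses u, it is not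
    -- of maximum weight, so `N` is heavier by at least one. If `R` covers u, its own weight has
    -- dropped by one under the peeling.
    by_cases hRu : Misses R u
    · refine ⟨N, hN, mono _ _ _ ?_ hPw⟩
      have h1 : ¬ ∑ e ∈ N, w e ≤ ∑ e ∈ R, w e := fun hle =>
        hu R hR (fun R' hR' => (hNmax R' hR').trans hle) hRu
      have h2 : ∑ e ∈ R, (w e - if e ∈ J then 1 else 0) ≤ ∑ e ∈ R, w e :=
        Finset.sum_le_sum fun e _ => Nat.sub_le _ _
      omega
    · refine ⟨R, hR, mono _ _ _ ?_ hPw⟩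
      unfold Misses at hRu
      push Not at hRu
      obtain ⟨e, he, hue⟩ := hRu
      refine Nat.succ_le_of_lt (Finset.sum_lt_sum (fun e _ => Nat.sub_le _ _) ⟨e, he, ?_⟩)
      have := hR.1 e he
      have heJ : e ∈ J := Finset.mem_filter.2 ⟨Finset.mem_univ e, this, hue⟩
      simp [heJ, this]
  · push Not at hcov
    obtain ⟨a, ha⟩ : ∃ a, a ∈ e₀ := ⟨_, e₀.out_fst_mem⟩
    set C := component {e | 0 < w e} a with hCdef
    have hC : ∀ R, IsMatchingIn w R → ClosedUnder R C := fun R hR =>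
      closedUnder_component hR.1 a
    set J := Finset.univ.filter fun e => 0 < w e ∧ e.toFinset ⊆ C with hJ
    have hJpos : ∀ e ∈ J, 0 < w e := fun e he => (Finset.mem_filter.1 he).2.1
    have he₀C : e₀.toFinset ⊆ C :=
      closedUnder_component (R := {e₀}) (fun e he => by simpa [Finset.mem_singleton.1 he]) a
        e₀ (Finset.mem_singleton_self _) a ha (self_mem_component _ a)
    obtain ⟨R, hR, hP⟩ := step J hJpos ⟨e₀, by simp [hJ, he₀, he₀C]⟩
    have hPw := add _ _ _ _ hP (clique C J fun e he => ⟨hdiag e (hJpos e he),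
      (Finset.mem_filter.1 he).2.2⟩)
    rw [sub_indicator_add hJpos] at hPw
    set w' : Sym2 V → ℕ := fun e => w e - if e ∈ J then 1 else 0 with hw'
    have hred : ReducedOn w w' C := fun e => by
      by_cases he : 0 < w e ∧ e.toFinset ⊆ C
      · simp only [hw', hJ, Finset.mem_filter, Finset.mem_univ, true_and, he, and_self, if_true]
        omega
      · simp [hw', hJ, he]
    -- The optimum is taken among matchings of `w`, so it has at least the `w'`-weight of `R`.
    obtain ⟨M, hM⟩ := exists_lexOptimal w w'
    refine ⟨M, hM.1, mono _ _ _ ?_ hPw⟩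
    have h1 : ∑ e ∈ R, w' e ≤ ∑ e ∈ M, w' e := by
      by_contra! hlt
      exact hlt.ne' (hM.2 R hR hlt.le).1
    have h2 := hred.sum_eq hM.1
    have h3 := two_mul_card_edgesIn hw hM.1 (hC M hM.1)
    -- With at most one vertex of C missed, `M` has exactly ⌊|C|/2⌋ edges inside C, which is the gap
    -- between its `w`- and `w'`-weights.
    have h4 : (C.filter (Misses M)).card ≤ 1 := by
      refine Finset.card_le_one.2 fun u hu v hv => ?_
      rw [Finset.mem_filter, mem_component] at hu hv
      by_contra huv
      obtain ⟨p⟩ := hu.1.symm.trans hv.1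
      refine hM.not_misses_of_walk hw hred hC (fun t _ => ?_) p (fun x hx => ?_) huv hu.2 hv.2
      · exact hcov t
      · exact mem_component.2 (hu.1.trans (p.takeUntil x hx).reachable)
    change ∑ e ∈ R, w' e + C.card / 2 ≤ _
    omega

end MatchingInduction

/-! ### Quadratic forms of token graphs -/

namespace TokenForm

theorem exists_eq_mk {V : Type*} {e : Sym2 V} (he : ¬ e.IsDiag) : ∃ a b, a ≠ b ∧ e = s(a, b) := by
  induction e using Sym2.ind with
  | _ a b => exact ⟨a, b, by simpa using he, rfl⟩

/-! ### Edges cut by a configuration, and flips -/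

section Cut

variable {V : Type*} [DecidableEq V]

/-- The set `s` contains exactly one endpoint of `e`. -/
def Cut (e : Sym2 V) (s : Finset V) : Prop := (s ∩ e.toFinset).card = 1

instance (e : Sym2 V) (s : Finset V) : Decidable (Cut e s) :=
  inferInstanceAs (Decidable (_ = 1))

/-- The ends must be distinct: a diagonal pair counts as cut as soon as its vertex lies in `s`.
Hence the off-diagonal hypotheses in the cut lemmas and the zero weights on the diagonal. -/
theorem cut_mk {a b : V} (hab : a ≠ b) (s : Finset V) :
    Cut s(a, b) s ↔ (a ∈ s ↔ b ∉ s) := by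
  unfold Cut
  rw [Sym2.toFinset_mk_eq]
  by_cases ha : a ∈ s <;> by_cases hb : b ∈ s <;> simp [ha, hb, hab, Finset.inter_insert_of_mem,
    Finset.inter_insert_of_notMem, Finset.inter_singleton_of_mem, Finset.inter_singleton_of_notMem]

theorem cut_symmDiff {e : Sym2 V} (he : ¬ e.IsDiag) (s : Finset V) :
    Cut e (s ∆ e.toFinset) ↔ Cut e s := by
  obtain ⟨a, b, hab, rfl⟩ := exists_eq_mk he
  rw [cut_mk hab, cut_mk hab]
  simp [Finset.mem_symmDiff]
  tauto

theorem cut_symmDiff_of_ne {e f : Sym2 V} (he : ¬ e.IsDiag) (hf : ¬ f.IsDiag) {u : V}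
    (hue : u ∈ e) (huf : u ∈ f) (hef : e ≠ f) (s : Finset V) :
    Cut f (s ∆ e.toFinset) ↔ ¬ Cut f s := by
  obtain ⟨v, rfl⟩ := Sym2.mem_iff_exists.1 hue
  obtain ⟨b, rfl⟩ := Sym2.mem_iff_exists.1 huf
  have huv : u ≠ v := by simpa using he
  have hub : u ≠ b := by simpa using hf
  have hvb : b ≠ v := fun h => hef (by rw [h])
  rw [cut_mk hub, cut_mk hub]
  simp [Finset.mem_symmDiff, hvb, hub.symm]
  tauto

theorem card_symmDiff_of_cut {e : Sym2 V} (he : ¬ e.IsDiag) {s : Finset V} (h : Cut e s) :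
    (s ∆ e.toFinset).card = s.card := by
  have h2 := Sym2.card_toFinset_of_not_isDiag e he
  have h1 : (s ∩ e.toFinset).card = 1 := h
  have h3 := Finset.card_sdiff_add_card_inter s e.toFinset
  have h4 := Finset.card_sdiff_add_card_inter e.toFinset s
  rw [Finset.inter_comm] at h4
  have h5 : (s ∆ e.toFinset).card = (s \ e.toFinset).card + (e.toFinset \ s).card := by
    rw [symmDiff_def]
    exact Finset.card_union_of_disjoint disjoint_sdiff_sdiff
  omega

theorem symmDiff_symmDiff_toFinset (e : Sym2 V) (s : Finset V) :
    (s ∆ e.toFinset) ∆ e.toFinset = s := by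
  rw [symmDiff_assoc, symmDiff_self, symmDiff_bot]

theorem not_cut_empty (e : Sym2 V) : ¬ Cut e ∅ := by simp [Cut]

/-- Flipping e toggles the centre u and the other end of e. So e stays cut, while every other edge
of the star changes its status. -/
theorem card_cut_add {u : V} {J : Finset (Sym2 V)} (hJ : ∀ e ∈ J, ¬ e.IsDiag ∧ u ∈ e)
    {e : Sym2 V} (he : e ∈ J) {s : Finset V} (hs : Cut e s) :
    (J.filter fun f => Cut f s).card + (J.filter fun f => Cut f (s ∆ e.toFinset)).card =
      J.card + 1 := by
  have h1 : (J.filter fun f => Cut f (s ∆ e.toFinset)) =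
      insert e (J.filter fun f => ¬ Cut f s) := by
    ext f
    rw [Finset.mem_insert, Finset.mem_filter, Finset.mem_filter]
    by_cases hfe : f = e
    · subst hfe
      simp [he, cut_symmDiff (hJ f he).1, hs]
    · simp only [hfe, false_or]
      refine and_congr_right fun hf => ?_
      exact cut_symmDiff_of_ne (hJ e he).1 (hJ f hf).1 (hJ e he).2 (hJ f hf).2 (Ne.symm hfe) s
  rw [h1, Finset.card_insert_of_notMem (by simp [hs]), ← add_assoc,
    Finset.card_filter_add_card_filter_not]

variable [Fintype V]

theorem cut_compl {e : Sym2 V} (he : ¬ e.IsDiag) (s : Finset V) : Cut e sᶜ ↔ Cut e s := by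
  obtain ⟨a, b, hab, rfl⟩ := exists_eq_mk he
  rw [cut_mk hab, cut_mk hab]
  simp
  tauto

/-- Flipping both endpoints of an edge, as a permutation of the configurations. -/
def flipEquiv (e : Sym2 V) : Finset V ≃ Finset V where
  toFun s := s ∆ e.toFinset
  invFun s := s ∆ e.toFinset
  left_inv := symmDiff_symmDiff_toFinset e
  right_inv := symmDiff_symmDiff_toFinset e

theorem sum_cut_symmDiff {e : Sym2 V} (he : ¬ e.IsDiag) (f : Finset V → ℝ) :
    (∑ s, if Cut e s then f (s ∆ e.toFinset) else 0) = ∑ s, if Cut e s then f s else 0 := by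
  rw [← Equiv.sum_comp (flipEquiv e) fun s => if Cut e s then f s else 0]
  refine Finset.sum_congr rfl fun s _ => ?_
  simp only [flipEquiv, Equiv.coe_fn_mk, cut_symmDiff he]

end Cut

/-! ### The form βD + γA and the star bound -/

section Form

variable {V : Type*} [DecidableEq V] [Fintype V]

/-- The contribution of a configuration to the quadratic form `β D + γ A` of all token graphs. -/
def formAt (β γ : ℝ) (w : Sym2 V → ℝ) (x : Finset V → ℝ) (s : Finset V) : ℝ :=
  ∑ e, if Cut e s then w e * (β * x s ^ 2 + γ * (x s * x (s ∆ e.toFinset))) else 0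

/-- The quadratic form `β D + γ A` on the disjoint union of all token graphs. -/
def form (β γ : ℝ) (w : Sym2 V → ℝ) (x : Finset V → ℝ) : ℝ := ∑ s, formAt β γ w x s

/-- The bound `λ_max ≤ (1 + β) / 2 * (W + a)` for the quadratic form `β D + γ A`. -/
def Bound (β γ : ℝ) (w : Sym2 V → ℝ) (a : ℝ) : Prop :=
  ∀ x, form β γ w x ≤ (1 + β) / 2 * (∑ e, w e + a) * ∑ s, x s ^ 2

theorem form_add (β γ : ℝ) (w w' : Sym2 V → ℝ) (x : Finset V → ℝ) :
    form β γ (w + w') x = form β γ w x + form β γ w' x := by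
  simp only [form, formAt, ← Finset.sum_add_distrib]
  refine Finset.sum_congr rfl fun s _ => Finset.sum_congr rfl fun e _ => ?_
  split_ifs <;> simp [add_mul]

theorem form_smul (β γ c : ℝ) (w : Sym2 V → ℝ) (x : Finset V → ℝ) :
    form β γ (c • w) x = c * form β γ w x := by
  simp only [form, formAt, Finset.mul_sum]
  refine Finset.sum_congr rfl fun s _ => Finset.sum_congr rfl fun e _ => ?_
  split_ifs <;> simp [mul_assoc]

theorem form_indicator (β γ : ℝ) (J : Finset (Sym2 V)) (x : Finset V → ℝ) :
    form β γ (fun e => if e ∈ J then 1 else 0) x = ∑ e ∈ J, ∑ s,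
      if Cut e s then β * x s ^ 2 + γ * (x s * x (s ∆ e.toFinset)) else 0 := by
  simp only [form, formAt]
  rw [Finset.sum_comm, ← Finset.sum_subset (Finset.subset_univ J)]
  · refine Finset.sum_congr rfl fun e he => ?_
    simp [he]
  · intro e _ he
    simp [he]

theorem bound_zero (β γ : ℝ) : Bound β γ (0 : Sym2 V → ℝ) 0 := by
  intro x
  simp [form, formAt]

theorem Bound.add {β γ : ℝ} {w w' : Sym2 V → ℝ} {a a' : ℝ} (h : Bound β γ w a)
    (h' : Bound β γ w' a') : Bound β γ (w + w') (a + a') := by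
  intro x
  rw [form_add]
  refine (add_le_add (h x) (h' x)).trans_eq ?_
  simp only [Pi.add_apply, Finset.sum_add_distrib]
  ring

theorem Bound.mono {β γ : ℝ} (hβ : 0 ≤ β) {w : Sym2 V → ℝ} {a a' : ℝ} (haa' : a ≤ a')
    (h : Bound β γ w a) : Bound β γ w a' := by
  intro x
  refine (h x).trans ?_
  gcongr

/-- Cauchy–Schwarz bounds (x + γy)² by the weighted sum of squares on the right; the difference is a
square over nm. For β = 1 the left side is (x + γy)². For β = 0 it is half of (x + γy)² - (x - γy)².
-/
theorem pair_bound {β γ : ℝ} (hβ : β = 0 ∨ β = 1) (hγ : γ ^ 2 = 1) {n m : ℝ} (hn : 0 < n)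
    (hm : 0 < m) (x y : ℝ) :
    β * x ^ 2 + β * y ^ 2 + 2 * (γ * (x * y)) ≤
      (1 + β) / 2 * ((n + m) / n * x ^ 2 + (n + m) / m * y ^ 2) := by
  have h : (x + γ * y) ^ 2 ≤ (n + m) / n * x ^ 2 + (n + m) / m * y ^ 2 := by
    have h1 : (n + m) / n * x ^ 2 + (n + m) / m * y ^ 2 - (x + γ * y) ^ 2 =
        (m * x - γ * (n * y)) ^ 2 / (n * m) := by
      field_simp
      linear_combination (-(n * m * y ^ 2) - n ^ 2 * y ^ 2) * hγ
    have h2 : 0 ≤ (m * x - γ * (n * y)) ^ 2 / (n * m) := by positivity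
    linarith
  have h3 : (x + γ * y) ^ 2 = x ^ 2 + 2 * (γ * (x * y)) + y ^ 2 := by
    linear_combination y ^ 2 * hγ
  have h4 : (x - γ * y) ^ 2 = x ^ 2 - 2 * (γ * (x * y)) + y ^ 2 := by
    linear_combination y ^ 2 * hγ
  have h5 := sq_nonneg (x - γ * y)
  rcases hβ with rfl | rfl <;> linarith

/-- Let n(s) be the number of star edges cut by s, and D = |J| + 1. For a flip along a star edge,
the values of n at its two ends add up to D, so `pair_bound` lets the end s be charged D/n(s) ·
x(s)². Each s is charged once per cut edge, hence D · x(s)² in total. -/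
theorem bound_star {β γ : ℝ} (hβ : β = 0 ∨ β = 1) (hγ : γ ^ 2 = 1) (u : V)
    (J : Finset (Sym2 V)) (hJ : ∀ e ∈ J, ¬ e.IsDiag ∧ u ∈ e) :
    Bound β γ (fun e => if e ∈ J then 1 else 0) 1 := by
  intro x
  have hβ0 : 0 ≤ (1 + β) / 2 := by rcases hβ with rfl | rfl <;> norm_num
  set D : ℝ := J.card + 1 with hD
  set n : Finset V → ℝ := fun s => (J.filter fun f => Cut f s).card with hn
  have hedge : ∀ e ∈ J, (∑ s, if Cut e s then β * x s ^ 2 + γ * (x s * x (s ∆ e.toFinset)) else 0)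
      ≤ ∑ s, if Cut e s then (1 + β) / 2 * (D / n s * x s ^ 2) else 0 := by
    intro e he
    have hd := (hJ e he).1
    -- Each sum over s is doubled by the involution s ↦ s ∆ e, so that the two ends of a flip can be
    -- compared together.
    have h1 := sum_cut_symmDiff hd fun s => β * x s ^ 2 + γ * (x s * x (s ∆ e.toFinset))
    have h2 := sum_cut_symmDiff hd fun s => (1 + β) / 2 * (D / n s * x s ^ 2)
    simp only [symmDiff_symmDiff_toFinset] at h1
    have h3 : (∑ s, if Cut e s then β * x s ^ 2 + γ * (x s * x (s ∆ e.toFinset)) else 0) +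
        (∑ s, if Cut e s then β * x (s ∆ e.toFinset) ^ 2 + γ * (x (s ∆ e.toFinset) * x s) else 0)
        ≤ (∑ s, if Cut e s then (1 + β) / 2 * (D / n s * x s ^ 2) else 0) +
        ∑ s, if Cut e s then (1 + β) / 2 * (D / n (s ∆ e.toFinset) * x (s ∆ e.toFinset) ^ 2)
          else 0 := by
      rw [← Finset.sum_add_distrib, ← Finset.sum_add_distrib]
      refine Finset.sum_le_sum fun s _ => ?_
      by_cases hs : Cut e s
      · simp only [hs, if_true]
        have hsum : n s + n (s ∆ e.toFinset) = D := by
          simp only [hn, hD]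
          exact_mod_cast card_cut_add hJ he hs
        have hpos : 0 < n s := by
          simp only [hn]
          exact_mod_cast Finset.card_pos.2 ⟨e, Finset.mem_filter.2 ⟨he, hs⟩⟩
        have hpos' : 0 < n (s ∆ e.toFinset) := by
          simp only [hn]
          exact_mod_cast Finset.card_pos.2
            ⟨e, Finset.mem_filter.2 ⟨he, (cut_symmDiff hd s).2 hs⟩⟩
        have := pair_bound hβ hγ hpos hpos' (x s) (x (s ∆ e.toFinset))
        rw [hsum] at this
        linarith
      · simp [hs]
    linarith
  rw [form_indicator]
  have hsumw : (∑ e : Sym2 V, if e ∈ J then (1 : ℝ) else 0) + 1 = D := by simp [hD]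
  rw [hsumw]
  refine (Finset.sum_le_sum hedge).trans ?_
  rw [Finset.sum_comm, Finset.mul_sum]
  refine Finset.sum_le_sum fun s _ => ?_
  rw [← Finset.sum_filter, Finset.sum_const, nsmul_eq_mul]
  change n s * _ ≤ _
  -- A configuration cutting no edge of the star is never charged, so the junk value of D/0 is
  -- harmless.
  rcases eq_or_ne (n s) 0 with h0 | h0
  · rw [h0, zero_mul]
    positivity
  · apply le_of_eq
    field_simp

end Form

end TokenForm

/-! ### Bounds on token graphs as bounds on quadratic forms -/

section Rayleigh

variable {ι : Type*} [Fintype ι] [DecidableEq ι]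

open Matrix in
theorem quadForm_le_of_spectrum_le {B : Matrix ι ι ℝ} (hB : B.IsHermitian) {c : ℝ}
    (h : ∀ r ∈ spectrum ℝ B, r ≤ c) (z : ι → ℝ) : z ⬝ᵥ (B *ᵥ z) ≤ c * (z ⬝ᵥ z) := by
  have hC : (algebraMap ℝ (Matrix ι ι ℝ) c - B).IsHermitian := by
    refine Matrix.IsHermitian.sub ?_ hB
    rw [Matrix.IsHermitian, Matrix.algebraMap_eq_diagonal]
    simp
  have hpos : (algebraMap ℝ (Matrix ι ι ℝ) c - B).PosSemidef := by
    rw [hC.posSemidef_iff_eigenvalues_nonneg]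
    intro i
    have hi := hC.eigenvalues_mem_spectrum_real i
    rw [← spectrum.singleton_sub_eq] at hi
    obtain ⟨a, ha, b, hb, hab⟩ := Set.mem_sub.1 hi
    rw [Set.mem_singleton_iff] at ha
    have := h b hb
    change 0 ≤ hC.eigenvalues i
    linarith
  have := hpos.dotProduct_mulVec_nonneg z
  rw [Matrix.sub_mulVec, dotProduct_sub, Algebra.algebraMap_eq_smul_one, Matrix.smul_mulVec,
    Matrix.one_mulVec, dotProduct_smul, smul_eq_mul] at this
  simp only [star_trivial] at this
  linarith

open Matrix in
theorem quadForm_le_of_lamMax_le {B : Matrix ι ι ℝ} (hB : B.IsHermitian) {c : ℝ}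
    (h : lamMax B ≤ c) (z : ι → ℝ) : z ⬝ᵥ (B *ᵥ z) ≤ c * (z ⬝ᵥ z) :=
  quadForm_le_of_spectrum_le hB
    (fun _ hr => (le_csSup B.finite_real_spectrum.bddAbove hr).trans h) z

open Matrix in
theorem quadForm_ge_of_lamMin_ge {B : Matrix ι ι ℝ} (hB : B.IsHermitian) {c : ℝ}
    (h : lamMin B ≥ -c) (z : ι → ℝ) : -(z ⬝ᵥ (B *ᵥ z)) ≤ c * (z ⬝ᵥ z) := by
  have := quadForm_le_of_spectrum_le hB.neg (c := c) (fun r hr => ?_) z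
  · rwa [Matrix.neg_mulVec, dotProduct_neg] at this
  · rw [← spectrum.neg_eq, Set.mem_neg] at hr
    have := h.trans (csInf_le B.finite_real_spectrum.bddBelow hr)
    linarith

end Rayleigh

namespace TokenForm

theorem weight_eq_zero_of_isDiag {V : Type*} (G : WGraph V) {e : Sym2 V} (he : e.IsDiag) :
    G.weight e = 0 :=
  G.weight_zero e fun h => G.graph.not_isDiag_of_mem_edgeSet h he

/-! ### Token graph matrices as quadratic forms -/

section Token

variable {V : Type*} [DecidableEq V]

theorem cut_of_card_symmDiff {e : Sym2 V} (he : ¬ e.IsDiag) {s : Finset V}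
    (h : s.card = (s ∆ e.toFinset).card) : Cut e s := by
  have h2 := Sym2.card_toFinset_of_not_isDiag e he
  have h3 := Finset.card_sdiff_add_card_inter s e.toFinset
  have h4 := Finset.card_sdiff_add_card_inter e.toFinset s
  rw [Finset.inter_comm] at h4
  have h5 : (s ∆ e.toFinset).card = (s \ e.toFinset).card + (e.toFinset \ s).card := by
    rw [symmDiff_def]
    exact Finset.card_union_of_disjoint disjoint_sdiff_sdiff
  change (s ∩ e.toFinset).card = 1
  omega

variable [Fintype V]

/-- The pair e is determined by A ∆ B, so the sum has at most one nonzero term. Equal cardinalities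
force A to contain exactly one end of it. -/
theorem tokenWeight_eq_sum (G : WGraph V) {A B : Finset V} (hAB : A.card = B.card) :
    G.tokenWeight A B = ∑ e, if Cut e A ∧ B = A ∆ e.toFinset then G.weight e else 0 := by
  by_cases h : ∃ e : Sym2 V, ¬ e.IsDiag ∧ A ∆ B = e.toFinset
  · obtain ⟨e, he, hABe⟩ := h
    obtain ⟨a, b, hab, rfl⟩ := exists_eq_mk he
    have hB : B = A ∆ s(a, b).toFinset := by
      rw [← hABe, ← symmDiff_assoc, symmDiff_self, bot_symmDiff]
    have huniq : ∀ f : Sym2 V, B = A ∆ f.toFinset → f = s(a, b) := by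
      intro f hf
      have : f.toFinset = s(a, b).toFinset := symmDiff_right_injective A (hf.symm.trans hB)
      refine (Sym2.mem_and_mem_iff hab).1 ⟨?_, ?_⟩ <;> rw [← Sym2.mem_toFinset, this] <;> simp
    rw [Finset.sum_eq_single s(a, b)]
    · have hcut : Cut s(a, b) A := cut_of_card_symmDiff he (hB ▸ hAB)
      rw [if_pos ⟨hcut, hB⟩]
      rw [Sym2.toFinset_mk_eq] at hABe
      rw [cut_mk hab] at hcut
      have hmem : ∀ v ∈ ({a, b} : Finset V), v ∉ A → v ∈ B := by
        intro v hv hvA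
        rw [← hABe, Finset.mem_symmDiff] at hv
        tauto
      by_cases ha : a ∈ A
      · exact G.tokenWeight_eq ha (hmem b (by simp) (hcut.1 ha)) hABe
      · have hb : b ∈ A := by tauto
        rw [Sym2.eq_swap]
        exact G.tokenWeight_eq hb (hmem a (by simp) ha) (by rw [hABe, Finset.pair_comm])
    · intro f _ hf
      exact if_neg fun h => hf (huniq f h.2)
    · simp
  · push Not at h
    rw [WGraph.tokenWeight, Finset.sum_eq_zero, Finset.sum_eq_zero]
    · intro e _
      split_ifs with he
      · refine weight_eq_zero_of_isDiag G (by_contra fun hd => h e hd ?_)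
        rw [he.2, ← symmDiff_assoc, symmDiff_self, bot_symmDiff]
      · rfl
    · intro a ha
      refine Finset.sum_eq_zero fun b hb => if_neg fun hd => ?_
      refine h s(a, b) (fun hab => ?_) (by rw [hd, Sym2.toFinset_mk_eq])
      have hab' : a = b := by simpa using hab
      subst hab'
      have : a ∈ A ∆ B := by simp [hd]
      simp [Finset.mem_symmDiff, ha, hb] at this

/-- The neighbours of A are the sets A ∆ e for the edges e cut by A, and such a flip stays among the
k-sets. -/
theorem sum_tokenWeight_mul (G : WGraph V) {k : ℕ} (A : WGraph.Token V k) (h : Finset V → ℝ) :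
    ∑ B : WGraph.Token V k, G.tokenWeight A.1 B.1 * h B.1 =
      ∑ e, if Cut e A.1 then G.weight e * h (A.1 ∆ e.toFinset) else 0 := by
  have hsum := fun B : WGraph.Token V k => tokenWeight_eq_sum G (A.2.trans B.2.symm)
  simp only [hsum, Finset.sum_mul]
  rw [Finset.sum_comm]
  refine Finset.sum_congr rfl fun e _ => ?_
  by_cases hd : e.IsDiag
  · simp [weight_eq_zero_of_isDiag G hd]
  by_cases hcut : Cut e A.1
  · rw [Finset.sum_eq_single ⟨A.1 ∆ e.toFinset, (card_symmDiff_of_cut hd hcut).trans A.2⟩]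
    · simp [hcut]
    · intro B _ hB
      rw [if_neg fun h => hB (Subtype.ext h.2), zero_mul]
    · simp
  · simp [hcut]

open Matrix in
theorem quadForm_token (β γ : ℝ) (G : WGraph V) (k : ℕ) (x : Finset V → ℝ) :
    (fun A : WGraph.Token V k => x A.1) ⬝ᵥ ((β • (G.tokenGraph k).degMat +
      γ • (G.tokenGraph k).adjMat) *ᵥ fun A => x A.1) =
      ∑ s ∈ Finset.univ.filter (fun s : Finset V => s.card = k), formAt β γ G.weight x s := by
  rw [Finset.sum_subtype (p := fun s : Finset V => s.card = k) _ (by simp)]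
  refine Finset.sum_congr rfl fun A _ => ?_
  have h1 := sum_tokenWeight_mul G A fun B => β * x A.1 ^ 2 + γ * (x A.1 * x B)
  rw [formAt, ← h1, Matrix.add_mulVec, Matrix.smul_mulVec, Matrix.smul_mulVec]
  simp only [Pi.add_apply, Pi.smul_apply, WGraph.degMat, Matrix.mulVec_diagonal, smul_eq_mul]
  have h2 : ∀ B : WGraph.Token V k, (G.tokenGraph k).weight s(A, B) = G.tokenWeight A.1 B.1 :=
    fun B => rfl
  simp only [WGraph.adjMat, Matrix.mulVec, dotProduct, Matrix.of_apply, h2, Finset.mul_sum,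
    Finset.sum_mul]
  rw [← Finset.sum_add_distrib, Finset.mul_sum]
  refine Finset.sum_congr rfl fun B _ => ?_
  ring

end Token

/-- The token graph conjecture for the matrices `β D + γ A`, as a bound on quadratic forms. -/
def TokenBound (β γ : ℝ) : Prop :=
  ∀ (n : ℕ) (G : SimpleGraph (Fin n)) (k : ℕ), 1 ≤ k → k ≤ n / 2 → ∀ x : Finset (Fin n) → ℝ,
    ∑ s ∈ Finset.univ.filter (fun s : Finset (Fin n) => s.card = k),
      formAt β γ (WGraph.ofSimple G).weight x s ≤
      (1 + β) / 2 * (G.edgeSet.ncard + k) *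
        ∑ s ∈ Finset.univ.filter (fun s : Finset (Fin n) => s.card = k), x s ^ 2

theorem isHermitian_degMat_add_adjMat (β γ : ℝ) {V : Type*} [DecidableEq V] [Fintype V]
    (G : WGraph V) : (β • G.degMat + γ • G.adjMat).IsHermitian := by
  refine Matrix.IsHermitian.ext fun i j => ?_
  simp only [WGraph.degMat, WGraph.adjMat, Matrix.add_apply, Matrix.smul_apply, Matrix.of_apply,
    star_trivial, Sym2.eq_swap (a := i)]
  congr 2
  rcases eq_or_ne i j with rfl | h
  · rfl
  · simp [h, h.symm]

open Matrix in
theorem sum_token_sq {V : Type*} [DecidableEq V] [Fintype V] (k : ℕ) (x : Finset V → ℝ) :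
    (fun A : WGraph.Token V k => x A.1) ⬝ᵥ (fun A : WGraph.Token V k => x A.1) =
      ∑ s ∈ Finset.univ.filter (fun s : Finset V => s.card = k), x s ^ 2 := by
  rw [Finset.sum_subtype (p := fun s : Finset V => s.card = k) _ (by simp)]
  exact Finset.sum_congr rfl fun A _ => (sq _).symm

theorem tokenBound_of_lamMax {β γ : ℝ}
    (h : ∀ (n : ℕ) (G : SimpleGraph (Fin n)) (k : ℕ), 1 ≤ k → k ≤ n / 2 →
      lamMax (β • ((WGraph.ofSimple G).tokenGraph k).degMat +
        γ • ((WGraph.ofSimple G).tokenGraph k).adjMat) ≤ (1 + β) / 2 * (G.edgeSet.ncard + k)) :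
    TokenBound β γ := by
  intro n G k hk hk' x
  rw [← quadForm_token, ← sum_token_sq]
  exact quadForm_le_of_lamMax_le (isHermitian_degMat_add_adjMat _ _ _) (h n G k hk hk') _

theorem tokenBound_of_conjLMax (h : ConjLMax) : TokenBound 1 (-1) := by
  refine tokenBound_of_lamMax fun n G k hk hk' => ?_
  have := h n G k hk hk'
  rwa [one_smul, neg_one_smul, ← sub_eq_add_neg, add_self_div_two, one_mul]

theorem tokenBound_of_conjQMax (h : ConjQMax) : TokenBound 1 1 := by
  refine tokenBound_of_lamMax fun n G k hk hk' => ?_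
  have := h n G k hk hk'
  rwa [one_smul, one_smul, add_self_div_two, one_mul]

theorem tokenBound_of_conjAMax (h : ConjAMax) : TokenBound 0 1 := by
  refine tokenBound_of_lamMax fun n G k hk hk' => ?_
  have := h n G k hk hk'
  rwa [one_smul, zero_smul, zero_add, add_zero]

theorem tokenBound_of_conjAMin (h : ConjAMin) : TokenBound 0 (-1) := by
  intro n G k hk hk' x
  have h1 := isHermitian_degMat_add_adjMat 0 1 ((WGraph.ofSimple G).tokenGraph k)
  rw [one_smul, zero_smul, zero_add] at h1
  rw [← quadForm_token, ← sum_token_sq, zero_smul, zero_add, neg_one_smul, Matrix.neg_mulVec,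
    dotProduct_neg, add_zero]
  exact quadForm_ge_of_lamMin_ge h1 (h n G k hk hk') _

/-! ### From the levels k ≤ n/2 to all configurations -/

section Levels

variable {β γ : ℝ}

/-- Complementation identifies `F_k` with `F_{n-k}`; this reaches the levels above n/2, which the
conjectures do not mention. -/
theorem formAt_compl {V : Type*} [DecidableEq V] [Fintype V] {w : Sym2 V → ℝ}
    (hw : ∀ e, e.IsDiag → w e = 0) (x : Finset V → ℝ) (s : Finset V) :
    formAt β γ w (fun t => x tᶜ) sᶜ = formAt β γ w x s := by
  refine Finset.sum_congr rfl fun e _ => ?_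
  by_cases hd : e.IsDiag
  · simp [hw e hd]
  have h : (sᶜ ∆ e.toFinset)ᶜ = s ∆ e.toFinset := by
    ext v
    simp [Finset.mem_symmDiff]
    tauto
  simp only [cut_compl hd, compl_compl, h]

/-- Flips preserve cardinality, so the form splits by levels. Level 0 cuts no edge, the levels from
1 to ⌊n/2⌋ use the hypothesis with k ≤ ⌊n/2⌋, and the others are complements of these. -/
theorem TokenBound.form_le (h : TokenBound β γ) (hβ : 0 ≤ β) {n : ℕ} (G : SimpleGraph (Fin n))
    (x : Finset (Fin n) → ℝ) : form β γ (WGraph.ofSimple G).weight x ≤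
      (1 + β) / 2 * (G.edgeSet.ncard + (n / 2 : ℕ)) * ∑ s, x s ^ 2 := by
  have hsplit : ∀ f : Finset (Fin n) → ℝ, ∑ s, f s =
      ∑ k ∈ Finset.range (n + 1), ∑ s ∈ Finset.univ.filter (fun s : Finset (Fin n) => s.card = k),
        f s := fun f => (Finset.sum_fiberwise_of_maps_to (fun s _ => by
          have := s.card_le_univ
          rw [Fintype.card_fin] at this
          simpa using Nat.lt_succ_of_le this) f).symm
  have hlow : ∀ (k : ℕ), k ≤ n / 2 → ∀ x : Finset (Fin n) → ℝ,
      ∑ s ∈ Finset.univ.filter (fun s : Finset (Fin n) => s.card = k),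
        formAt β γ (WGraph.ofSimple G).weight x s ≤
      (1 + β) / 2 * (G.edgeSet.ncard + (n / 2 : ℕ)) *
        ∑ s ∈ Finset.univ.filter (fun s : Finset (Fin n) => s.card = k), x s ^ 2 := by
    intro k hk x
    rcases Nat.eq_zero_or_pos k with rfl | hk0
    · refine (Finset.sum_nonpos fun s hs => ?_).trans (by positivity)
      have : s = ∅ := by simpa using hs
      subst this
      simp [formAt, not_cut_empty]
    · refine (h n G k hk0 hk x).trans ?_
      gcongr
  have hcompl : ∀ (k : ℕ), k ≤ n → ∀ f : Finset (Fin n) → ℝ,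
      ∑ s ∈ Finset.univ.filter (fun s : Finset (Fin n) => s.card = k), f s =
      ∑ s ∈ Finset.univ.filter (fun s : Finset (Fin n) => s.card = n - k), f sᶜ := by
    intro k hk f
    refine Finset.sum_nbij' compl compl ?_ ?_ ?_ ?_ ?_
    · intro s hs
      have : s.card = k := by simpa using hs
      simp [Finset.card_compl, this]
    · intro s hs
      have : s.card = n - k := by simpa using hs
      simp [Finset.card_compl, this]
      omega
    · simp
    · simp
    · simp
  rw [form, hsplit, hsplit, Finset.mul_sum]
  refine Finset.sum_le_sum fun k hk => ?_
  have hkn : k ≤ n := Nat.lt_succ_iff.1 (Finset.mem_range.1 hk)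
  by_cases hk2 : k ≤ n / 2
  · exact hlow k hk2 x
  · rw [hcompl k hkn, hcompl k hkn fun s => x s ^ 2]
    refine le_trans (Finset.sum_le_sum fun s _ => ?_) (hlow (n - k) (by omega) fun s => x sᶜ)
    rw [← formAt_compl (fun e he => weight_eq_zero_of_isDiag _ he), compl_compl]

end Levels

end TokenForm

namespace TokenForm

/-! ### The bound for edges inside a vertex set -/

section Clique

variable {V : Type*} [DecidableEq V]

theorem cut_union_map {c : ℕ} {φ : Fin c ↪ V} {U : Finset V} (hU : ∀ i, φ i ∉ U)
    {e : Sym2 (Fin c)} (he : ¬ e.IsDiag) (T : Finset (Fin c)) :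
    Cut (e.map φ) (U ∪ T.map φ) ↔ Cut e T := by
  obtain ⟨a, b, hab, rfl⟩ := exists_eq_mk he
  rw [Sym2.map_mk, cut_mk (φ.injective.ne hab), cut_mk hab]
  simp [hU]

theorem union_map_symmDiff {c : ℕ} {φ : Fin c ↪ V} {U : Finset V} (hU : ∀ i, φ i ∉ U)
    (e : Sym2 (Fin c)) (T : Finset (Fin c)) :
    (U ∪ T.map φ) ∆ (e.map φ).toFinset = U ∪ (T ∆ e.toFinset).map φ := by
  have h : (e.map φ).toFinset = e.toFinset.map φ := by
    ext v
    simp [Sym2.mem_toFinset, Sym2.mem_map]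
  rw [h]
  ext v
  by_cases hv : ∃ i, φ i = v
  · obtain ⟨i, rfl⟩ := hv
    simp only [Finset.mem_symmDiff, Finset.mem_union, Finset.mem_map', hU, false_or]
  · have hm : ∀ S : Finset (Fin c), v ∉ S.map φ := fun S hS => by
      obtain ⟨i, _, hi⟩ := Finset.mem_map.1 hS
      exact hv ⟨i, hi⟩
    simp [Finset.mem_symmDiff, -Finset.mem_map, hm]

variable [Fintype V]

theorem sum_eq_sum_union_map {C : Finset V} {c : ℕ} {φ : Fin c ↪ V}
    (hφ : ∀ v, v ∈ C ↔ ∃ i, φ i = v) (f : Finset V → ℝ) :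
    ∑ s, f s = ∑ U ∈ Cᶜ.powerset, ∑ T : Finset (Fin c), f (U ∪ T.map φ) := by
  rw [← Finset.sum_product']
  refine Finset.sum_nbij' (fun s => (s \ C, s.preimage φ φ.injective.injOn))
    (fun p => p.1 ∪ p.2.map φ) ?_ ?_ ?_ ?_ ?_
  · intro s _
    simp only [Finset.mem_product, Finset.mem_powerset, Finset.mem_univ, and_true]
    exact fun v hv => Finset.mem_compl.2 (Finset.mem_sdiff.1 hv).2
  · simp
  · intro s _
    ext v
    simp only [Finset.mem_union, Finset.mem_sdiff, Finset.mem_map, Finset.mem_preimage, hφ]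
    constructor
    · rintro (h | ⟨i, hi, rfl⟩)
      exacts [h.1, hi]
    · intro hv
      by_cases h : ∃ i, φ i = v
      · obtain ⟨i, rfl⟩ := h
        exact Or.inr ⟨i, hv, rfl⟩
      · exact Or.inl ⟨hv, h⟩
  · rintro ⟨U, T⟩ hUT
    simp only [Finset.mem_product, Finset.mem_powerset, Finset.mem_univ, and_true] at hUT
    have hU : ∀ v ∈ U, ¬ ∃ i, φ i = v := fun v hv h =>
      Finset.mem_compl.1 (hUT hv) ((hφ v).2 h)
    refine Prod.ext ?_ ?_
    · ext v
      simp only [Finset.mem_sdiff, Finset.mem_union, Finset.mem_map, hφ]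
      constructor
      · rintro ⟨h | ⟨i, _, hi⟩, h'⟩
        exacts [h, absurd ⟨i, hi⟩ h']
      · exact fun h => ⟨Or.inl h, hU v h⟩
    · ext i
      simp only [Finset.mem_preimage, Finset.mem_union, Finset.mem_map']
      exact or_iff_right fun h => hU _ h ⟨i, rfl⟩
  · intro s _
    congr 1
    ext v
    simp only [Finset.mem_union, Finset.mem_sdiff, Finset.mem_map, Finset.mem_preimage, hφ]
    constructor
    · intro hv
      by_cases h : ∃ i, φ i = v
      · obtain ⟨i, rfl⟩ := h
        exact Or.inr ⟨i, hv, rfl⟩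
      · exact Or.inl ⟨hv, h⟩
    · rintro (h | ⟨i, hi, rfl⟩)
      exacts [h.1, hi]

/-- Edges inside C never change the configuration U outside C. For each fixed U the form is
therefore a copy of the form of the graph J, carried over to `Fin C.card`. -/
theorem TokenBound.bound_clique {β γ : ℝ} (h : TokenBound β γ) (hβ : 0 ≤ β) (C : Finset V)
    (J : Finset (Sym2 V)) (hJ : ∀ e ∈ J, ¬ e.IsDiag ∧ e.toFinset ⊆ C) :
    Bound β γ (fun e => if e ∈ J then 1 else 0) (C.card / 2 : ℕ) := by
  classical
  intro x
  set φ : Fin C.card ↪ V := C.equivFin.symm.toEmbedding.trans (Function.Embedding.subtype _)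
  have hφ : ∀ v, v ∈ C ↔ ∃ i, φ i = v := by
    intro v
    constructor
    · exact fun hv => ⟨C.equivFin ⟨v, hv⟩, by simp [φ]⟩
    · rintro ⟨i, rfl⟩
      exact (C.equivFin.symm i).2
  have hinj : Function.Injective (Sym2.map φ) := Sym2.map.injective φ.injective
  set G : SimpleGraph (Fin C.card) := SimpleGraph.fromEdgeSet {e | e.map φ ∈ J} with hG
  have hGe : ∀ e, e ∈ G.edgeSet ↔ e.map φ ∈ J := by
    intro e
    rw [hG, SimpleGraph.edgeSet_fromEdgeSet]
    refine ⟨fun he => he.1, fun he => ⟨he, fun hd => (hJ _ he).1 ?_⟩⟩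
    exact (Sym2.isDiag_map φ.injective).2 hd
  have hrange : ∀ e ∈ J, ∃ e', Sym2.map φ e' = e := by
    intro e he
    obtain ⟨-, hC⟩ := hJ e he
    induction e using Sym2.ind with
    | _ a b =>
      obtain ⟨i, hi⟩ := (hφ a).1 (hC (by simp))
      obtain ⟨j, hj⟩ := (hφ b).1 (hC (by simp))
      exact ⟨s(i, j), by rw [Sym2.map_mk, hi, hj]⟩
  have hcard : (G.edgeSet.ncard : ℝ) = J.card := by
    rw [← Set.ncard_image_of_injective _ hinj, ← Set.ncard_coe_finset J]
    congr 2
    ext e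
    simp only [Set.mem_image, hGe, Finset.mem_coe]
    constructor
    · rintro ⟨e', he', rfl⟩
      exact he'
    · intro he
      obtain ⟨e', rfl⟩ := hrange e he
      exact ⟨e', he, rfl⟩
  have hform : ∀ U ∈ Cᶜ.powerset, ∀ T,
      formAt β γ (fun e => if e ∈ J then 1 else 0) x (U ∪ T.map φ) =
        formAt β γ (WGraph.ofSimple G).weight (fun T => x (U ∪ T.map φ)) T := by
    intro U hU T
    have hU' : ∀ i, φ i ∉ U := fun i hi =>
      Finset.mem_compl.1 (Finset.mem_powerset.1 hU hi) ((hφ _).2 ⟨i, rfl⟩)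
    symm
    refine Finset.sum_of_injOn (Sym2.map φ) hinj.injOn (by simp) ?_ ?_
    · intro e _ he
      have : e ∉ J := fun heJ => he (by
        obtain ⟨e', rfl⟩ := hrange e heJ
        exact ⟨e', by simp, rfl⟩)
      simp [this]
    · intro e _
      have hwt : (WGraph.ofSimple G).weight e = if e.map φ ∈ J then 1 else 0 := by
        simp only [WGraph.ofSimple, hGe]
      by_cases heJ : e.map φ ∈ J
      · have hd : ¬ e.IsDiag := fun hd => (hJ _ heJ).1 ((Sym2.isDiag_map φ.injective).2 hd)
        rw [hwt]
        simp only [cut_union_map hU' hd, union_map_symmDiff hU']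
      · simp [hwt, heJ]
  have hsum : ∑ e : Sym2 V, (if e ∈ J then (1 : ℝ) else 0) = G.edgeSet.ncard := by
    rw [hcard]
    simp
  rw [hsum, form, sum_eq_sum_union_map hφ, sum_eq_sum_union_map hφ, Finset.mul_sum]
  refine Finset.sum_le_sum fun U hU => ?_
  rw [Finset.sum_congr rfl fun T _ => hform U hU T]
  exact h.form_le hβ G _

end Clique

/-! ### From integer to real weights -/

section Weighted

theorem weight_nonneg {V : Type*} (G : WGraph V) (e : Sym2 V) : 0 ≤ G.weight e := by
  by_cases he : e ∈ G.graph.edgeSet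
  · exact (G.weight_pos e he).le
  · exact (G.weight_zero e he).ge

theorem totalWeight_eq_sum {V : Type*} [Fintype V] (G : WGraph V) : G.totalWeight = ∑ e, G.weight e := by
  classical
  refine Finset.sum_subset (Finset.subset_univ _) fun e _ he => G.weight_zero e ?_
  simpa using he

theorem totalWeight_nonneg {V : Type*} [Fintype V] (G : WGraph V) : 0 ≤ G.totalWeight := by
  rw [totalWeight_eq_sum]
  exact Finset.sum_nonneg fun e _ => weight_nonneg G e

variable {V : Type*} [DecidableEq V] [Fintype V]

theorem TokenBound.exists_matching {β γ : ℝ} (h : TokenBound β γ) (hβ : β = 0 ∨ β = 1)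
    (hγ : γ ^ 2 = 1) (w : Sym2 V → ℕ) (hw : ∀ e, e.IsDiag → w e = 0) :
    ∃ R, MatchingInduction.IsMatchingIn w R ∧
      Bound β γ (fun e => (w e : ℝ)) (∑ e ∈ R, (w e : ℝ)) := by
  have hβ0 : 0 ≤ β := by rcases hβ with rfl | rfl <;> norm_num
  obtain ⟨R, hR, hP⟩ := MatchingInduction.exists_matching_bound
    (fun (w : Sym2 V → ℕ) a => Bound β γ (fun e => (w e : ℝ)) (a : ℝ))
    (by
      simp only [Pi.zero_apply, Nat.cast_zero]
      exact bound_zero (V := V) β γ)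
    (fun w w' a a' h h' => by
      have := h.add h'
      simp only [Pi.add_apply, Nat.cast_add]
      exact this)
    (fun w a a' haa' h => h.mono hβ0 (by exact_mod_cast haa'))
    (fun u J hJ => by
      simp only [Nat.cast_ite, Nat.cast_one, Nat.cast_zero]
      exact bound_star hβ hγ u J hJ)
    (fun C J hJ => by
      simp only [Nat.cast_ite, Nat.cast_one, Nat.cast_zero]
      exact h.bound_clique hβ0 C J hJ)
    w hw
  exact ⟨R, hR, by simpa using hP⟩

theorem sum_le_maxMatching (G : WGraph V) {R : Finset (Sym2 V)} (hR : G.IsMatching R) :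
    ∑ e ∈ R, G.weight e ≤ G.maxMatching := by
  classical
  exact Finset.le_sup' (fun R => ∑ e ∈ R, G.weight e) (Finset.mem_filter.2 ⟨Finset.mem_univ _, hR⟩)

theorem maxMatching_nonneg (G : WGraph V) : 0 ≤ G.maxMatching := by
  simpa using sum_le_maxMatching G G.isMatching_empty

theorem le_of_forall_nat_mul_le {a b B : ℝ} (h : ∀ N : ℕ, N * a ≤ N * b + B) : a ≤ b := by
  by_contra! hab
  obtain ⟨N, hN⟩ := exists_nat_gt (B / (a - b))
  rw [div_lt_iff₀ (sub_pos.2 hab)] at hN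
  linarith [h N]

/-- The integer case is applied to the weights ⌊N·w⌋. Their positive pairs are edges of G, so the
matching found is one of G, and the rounding error becomes negligible after division by N. -/
theorem TokenBound.form_weight_le {β γ : ℝ} (h : TokenBound β γ) (hβ : β = 0 ∨ β = 1)
    (hγ : γ ^ 2 = 1) (G : WGraph V) (x : Finset V → ℝ) :
    form β γ G.weight x ≤ (1 + β) / 2 * (G.totalWeight + G.maxMatching) * ∑ s, x s ^ 2 := by
  have hβ0 : 0 ≤ (1 + β) / 2 := by rcases hβ with rfl | rfl <;> norm_num
  -- The fractional parts lie in [0, 1], so their form is bounded by a constant depending on x but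
  -- not on N.
  obtain ⟨B, hB⟩ : ∃ B, ∀ w : Sym2 V → ℝ, (∀ e, 0 ≤ w e ∧ w e ≤ 1) → form β γ w x ≤ B := by
    refine ⟨∑ s, ∑ e : Sym2 V, |β * x s ^ 2 + γ * (x s * x (s ∆ e.toFinset))|, fun w hw => ?_⟩
    refine Finset.sum_le_sum fun s _ => Finset.sum_le_sum fun e _ => ?_
    split_ifs
    · refine (le_abs_self _).trans ?_
      rw [abs_mul, abs_of_nonneg (hw e).1]
      exact mul_le_of_le_one_left (abs_nonneg _) (hw e).2
    · exact abs_nonneg _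
  refine le_of_forall_nat_mul_le (B := B) fun N => ?_
  set w : Sym2 V → ℕ := fun e => ⌊(N : ℝ) * G.weight e⌋₊ with hw
  have hle : ∀ e, (w e : ℝ) ≤ N * G.weight e := fun e =>
    Nat.floor_le (mul_nonneg N.cast_nonneg (weight_nonneg G e))
  have hlt : ∀ e, N * G.weight e < w e + 1 := fun e => Nat.lt_floor_add_one _
  obtain ⟨R, hR, hbound⟩ := h.exists_matching hβ hγ w fun e he => by
    simp [hw, weight_eq_zero_of_isDiag G he]
  have hRG : G.IsMatching R := by
    refine ⟨fun e he => by_contra fun hne => ?_, fun v => Finset.card_le_one.2 ?_⟩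
    · have := hR.1 e he
      simp [hw, G.weight_zero e hne] at this
    · intro e he f hf
      rw [Finset.mem_filter] at he hf
      exact hR.2 e he.1 f hf.1 v he.2 hf.2
  have h1 : ∑ e, (w e : ℝ) ≤ N * G.totalWeight := by
    rw [totalWeight_eq_sum, Finset.mul_sum]
    exact Finset.sum_le_sum fun e _ => hle e
  have h2 : ∑ e ∈ R, (w e : ℝ) ≤ N * G.maxMatching := by
    refine le_trans ?_ (mul_le_mul_of_nonneg_left (sum_le_maxMatching G hRG) N.cast_nonneg)
    rw [Finset.mul_sum]
    exact Finset.sum_le_sum fun e _ => hle e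
  have h3 := hB (fun e => N * G.weight e - w e) fun e => ⟨by linarith [hle e], by linarith [hlt e]⟩
  have h4 : (N : ℝ) • G.weight = (fun e => (w e : ℝ)) + fun e => N * G.weight e - w e := by
    funext e
    simp
  have h5 := form_smul β γ N G.weight x
  rw [h4, form_add] at h5
  have h6 : (1 + β) / 2 * (∑ e, (w e : ℝ) + ∑ e ∈ R, (w e : ℝ)) * ∑ s, x s ^ 2 ≤
      (1 + β) / 2 * (N * G.totalWeight + N * G.maxMatching) * ∑ s, x s ^ 2 := by
    gcongr
  have h7 := hbound x
  linarith

end Weighted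

end TokenForm

/-! ### Hamiltonians as quadratic forms -/

section Entries

variable {V : Type*} [DecidableEq V]

/-- The computational basis state in which exactly the qubits in `s` are `1`. -/
def basisState (s : Finset V) : V → Fin 2 := fun v => if v ∈ s then 1 else 0

theorem eq_iff_agree {a b : V} {s t : Finset V} :
    t = s ↔ (∀ v, v ≠ a → v ≠ b → (v ∈ t ↔ v ∈ s)) ∧ (a ∈ t ↔ a ∈ s) ∧ (b ∈ t ↔ b ∈ s) := by
  constructor
  · rintro rfl
    simp
  · rintro ⟨h, ha, hb⟩
    ext v
    by_cases hva : v = a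
    · rwa [hva]
    by_cases hvb : v = b
    · rwa [hvb]
    exact h v hva hvb

theorem eq_symmDiff_iff_agree {a b : V} {s t : Finset V} :
    t = s ∆ s(a, b).toFinset ↔ (∀ v, v ≠ a → v ≠ b → (v ∈ t ↔ v ∈ s)) ∧
      (a ∈ t ↔ a ∉ s) ∧ (b ∈ t ↔ b ∉ s) := by
  rw [eq_iff_agree (a := a) (b := b)]
  refine and_congr (forall_congr' fun v => forall_congr' fun ha => forall_congr' fun hb => ?_) ?_
  · simp [Finset.mem_symmDiff, ha, hb]
  · simp [Finset.mem_symmDiff]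

variable [Fintype V]

theorem basisState_bijective : Function.Bijective (basisState : Finset V → V → Fin 2) := by
  constructor
  · intro s t h
    ext v
    have := congrFun h v
    unfold basisState at this
    by_cases hs : v ∈ s <;> by_cases ht : v ∈ t <;> simp_all
  · intro x
    refine ⟨Finset.univ.filter fun v => x v = 1, funext fun v => ?_⟩
    unfold basisState
    by_cases h : x v = 1
    · simp [h]
    · have : x v = 0 := by omega
      simp [this]

theorem one_basisState (s t : Finset V) :
    (1 : Matrix (V → Fin 2) (V → Fin 2) ℂ) (basisState s) (basisState t) =
      if t = s then 1 else 0 := by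
  rw [Matrix.one_apply]
  simp only [basisState_bijective.1.eq_iff, eq_comm (a := s)]

theorem edgeOp_basisState (P : Matrix (Fin 2) (Fin 2) ℂ) {a b : V} (hab : a ≠ b)
    (s t : Finset V) : edgeOp P s(a, b) (basisState s) (basisState t) =
      if ∀ v, v ≠ a → v ≠ b → (v ∈ t ↔ v ∈ s) then
        P (basisState s a) (basisState t a) * P (basisState s b) (basisState t b) else 0 := by
  have h1 : ∀ v, v ≠ a → v ≠ b → (if v ∈ s(a, b) then P else 1) (basisState s v) (basisState t v) =
      if v ∈ t ↔ v ∈ s then 1 else 0 := by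
    intro v ha hb
    rw [if_neg (by simp [ha, hb]), Matrix.one_apply]
    unfold basisState
    by_cases hs : v ∈ s <;> by_cases ht : v ∈ t <;> simp [hs, ht]
  simp only [edgeOp, tensorOp, Matrix.of_apply]
  split_ifs with h
  · rw [← Finset.prod_subset (Finset.subset_univ {a, b}), Finset.prod_pair hab]
    · simp
    · intro v _ hv
      simp only [Finset.mem_insert, Finset.mem_singleton, not_or] at hv
      rw [h1 v hv.1 hv.2, if_pos (h v hv.1 hv.2)]
  · push Not at h
    obtain ⟨v, ha, hb, hv⟩ := h
    refine Finset.prod_eq_zero (Finset.mem_univ v) ?_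
    rw [h1 v ha hb, if_neg]
    tauto

open TokenForm

theorem edgeOp_pauliX {e : Sym2 V} (he : ¬ e.IsDiag) (s t : Finset V) :
    edgeOp pauliX e (basisState s) (basisState t) = if t = s ∆ e.toFinset then 1 else 0 := by
  obtain ⟨a, b, hab, rfl⟩ := exists_eq_mk he
  rw [edgeOp_basisState _ hab]
  simp only [eq_symmDiff_iff_agree, ite_and]
  refine if_congr Iff.rfl ?_ rfl
  by_cases h1 : a ∈ s <;> by_cases h2 : b ∈ s <;> by_cases h3 : a ∈ t <;> by_cases h4 : b ∈ t <;>
    simp [basisState, pauliX, h1, h2, h3, h4]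

/-- The phases ±i multiply to 1 when the two qubits differ and to -1 when they agree. Hence XX + YY
is twice the flip on cut pairs and vanishes elsewhere, which is why QMC and XY preserve the number
of ones. -/
theorem edgeOp_pauliY {e : Sym2 V} (he : ¬ e.IsDiag) (s t : Finset V) :
    edgeOp pauliY e (basisState s) (basisState t) =
      if t = s ∆ e.toFinset then if Cut e s then 1 else -1 else 0 := by
  obtain ⟨a, b, hab, rfl⟩ := exists_eq_mk he
  rw [edgeOp_basisState _ hab]
  simp only [eq_symmDiff_iff_agree, ite_and, cut_mk hab]
  refine if_congr Iff.rfl ?_ rfl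
  by_cases h1 : a ∈ s <;> by_cases h2 : b ∈ s <;> by_cases h3 : a ∈ t <;> by_cases h4 : b ∈ t <;>
    simp [basisState, pauliY, h1, h2, h3, h4]

theorem edgeOp_pauliZ {e : Sym2 V} (he : ¬ e.IsDiag) (s t : Finset V) :
    edgeOp pauliZ e (basisState s) (basisState t) =
      if t = s then if Cut e s then -1 else 1 else 0 := by
  obtain ⟨a, b, hab, rfl⟩ := exists_eq_mk he
  rw [edgeOp_basisState _ hab]
  simp only [eq_iff_agree (a := a) (b := b), ite_and, cut_mk hab]
  refine if_congr Iff.rfl ?_ rfl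
  by_cases h1 : a ∈ s <;> by_cases h2 : b ∈ s <;> by_cases h3 : a ∈ t <;> by_cases h4 : b ∈ t <;>
    simp [basisState, pauliZ, h1, h2, h3, h4]

/-- The two signs cancel. This absorbs the sign in the rotation Y ↦ -Z. -/
theorem edgeOp_neg (P : Matrix (Fin 2) (Fin 2) ℂ) {e : Sym2 V} (he : ¬ e.IsDiag)
    (s t : Finset V) : edgeOp (-P) e (basisState s) (basisState t) =
      edgeOp P e (basisState s) (basisState t) := by
  obtain ⟨a, b, hab, rfl⟩ := exists_eq_mk he
  simp [edgeOp_basisState _ hab]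

/-- A two-qubit interaction that acts as `α + β D + γ A` on configurations. -/
def ActsAs (α β γ : ℝ) (h : Sym2 V → Matrix (V → Fin 2) (V → Fin 2) ℂ) : Prop :=
  ∀ e, ¬ e.IsDiag → ∀ s t, h e (basisState s) (basisState t) =
    (((if t = s then α else 0) + if Cut e s then (if t = s then β else 0) +
      (if t = s ∆ e.toFinset then γ else 0) else 0 : ℝ) : ℂ)

theorem actsAs_termQMC : ActsAs 0 1 (-1) (termQMC (V := V)) := by
  intro e he s t
  simp only [termQMC, Matrix.smul_apply, Matrix.sub_apply, one_basisState, edgeOp_pauliX he,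
    edgeOp_pauliY he, edgeOp_pauliZ he, smul_eq_mul]
  split_ifs <;> norm_num

theorem actsAs_termXY : ActsAs (1 / 2) 0 (-1) (termXY (V := V)) := by
  intro e he s t
  simp only [termXY, Matrix.smul_apply, Matrix.sub_apply, one_basisState, edgeOp_pauliX he,
    edgeOp_pauliY he, smul_eq_mul]
  split_ifs <;> norm_num

/-- The EPR interaction after a rotation of all qubits about the `X` axis. -/
noncomputable def termRotatedEPR (e : Sym2 V) : Matrix (V → Fin 2) (V → Fin 2) ℂ :=
  (1 / 2 : ℂ) • (1 + edgeOp pauliX e - edgeOp (-pauliZ) e + edgeOp pauliY e)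

theorem actsAs_termRotatedEPR : ActsAs 0 1 1 (termRotatedEPR (V := V)) := by
  intro e he s t
  simp only [termRotatedEPR, Matrix.smul_apply, Matrix.sub_apply, Matrix.add_apply, one_basisState,
    edgeOp_pauliX he, edgeOp_pauliY he, edgeOp_neg _ he, edgeOp_pauliZ he, smul_eq_mul]
  split_ifs <;> norm_num

end Entries

/-! ### Rotating the EPR Hamiltonian -/

section Rotation

theorem tensorOp_one {V : Type*} [Fintype V] : tensorOp (fun _ : V => 1) = 1 := by
  ext x y
  simp only [tensorOp, Matrix.of_apply, Matrix.one_apply, funext_iff]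
  split_ifs with h
  · simp [h]
  · push Not at h
    obtain ⟨v, hv⟩ := h
    exact Finset.prod_eq_zero (Finset.mem_univ v) (by simp [hv])

variable {V : Type*} [Fintype V] [DecidableEq V]

theorem tensorOp_mul (P Q : V → Matrix (Fin 2) (Fin 2) ℂ) :
    tensorOp P * tensorOp Q = tensorOp fun v => P v * Q v := by
  ext x z
  simp only [tensorOp, Matrix.mul_apply, Matrix.of_apply, ← Finset.prod_mul_distrib]
  rw [Finset.prod_univ_sum, Fintype.piFinset_univ]

/-- The rotation of one qubit about the `X` axis by a right angle, up to a scalar. -/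
noncomputable def rotX : Matrix (Fin 2) (Fin 2) ℂ := !![1, Complex.I; Complex.I, 1]

/-- The inverse of `rotX`. -/
noncomputable def rotXInv : Matrix (Fin 2) (Fin 2) ℂ := (1 / 2 : ℂ) • !![1, -Complex.I; -Complex.I, 1]

theorem rotX_mul_rotXInv : rotX * rotXInv = 1 := by
  ext i j
  fin_cases i <;> fin_cases j <;> simp [rotX, rotXInv] <;> ring_nf <;> norm_num [Complex.I_sq]

theorem rotXInv_mul_rotX : rotXInv * rotX = 1 := by
  ext i j
  fin_cases i <;> fin_cases j <;> simp [rotX, rotXInv] <;> ring_nf <;> norm_num [Complex.I_sq]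

theorem rotX_conj_pauliX : rotX * pauliX * rotXInv = pauliX := by
  ext i j
  fin_cases i <;> fin_cases j <;> simp [rotX, rotXInv, pauliX] <;> ring_nf <;> norm_num

theorem rotX_conj_pauliY : rotX * pauliY * rotXInv = -pauliZ := by
  ext i j
  fin_cases i <;> fin_cases j <;> simp [rotX, rotXInv, pauliY, pauliZ] <;> ring_nf <;> norm_num

theorem rotX_conj_pauliZ : rotX * pauliZ * rotXInv = pauliY := by
  ext i j
  fin_cases i <;> fin_cases j <;> simp [rotX, rotXInv, pauliY, pauliZ] <;> ring_nf <;> norm_num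

/-- The simultaneous rotation of all qubits. -/
noncomputable def rotAll : (Matrix (V → Fin 2) (V → Fin 2) ℂ)ˣ where
  val := tensorOp fun _ => rotX
  inv := tensorOp fun _ => rotXInv
  val_inv := by rw [tensorOp_mul, rotX_mul_rotXInv, tensorOp_one]
  inv_val := by rw [tensorOp_mul, rotXInv_mul_rotX, tensorOp_one]

theorem rotAll_conj_edgeOp (P : Matrix (Fin 2) (Fin 2) ℂ) (e : Sym2 V) :
    (rotAll (V := V)).val * edgeOp P e * (rotAll (V := V)).inv =
      edgeOp (rotX * P * rotXInv) e := by
  simp only [rotAll, edgeOp, tensorOp_mul]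
  congr 1
  funext v
  split_ifs
  · rfl
  · rw [mul_one, rotX_mul_rotXInv]

theorem rotAll_conj_termEPR (e : Sym2 V) :
    (rotAll (V := V)).val * termEPR e * (rotAll (V := V)).inv = termRotatedEPR e := by
  have h1 : (rotAll (V := V)).val * (rotAll (V := V)).inv = 1 := rotAll.val_inv
  simp only [termEPR, termRotatedEPR, mul_add, mul_sub, add_mul, sub_mul, Matrix.mul_smul,
    Matrix.smul_mul, rotAll_conj_edgeOp, mul_one, h1, rotX_conj_pauliX, rotX_conj_pauliY,
    rotX_conj_pauliZ]

/-- In the original basis XX - YY flips pairs of equal qubits, so the number of ones is not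
preserved. Rotating every qubit about X sends Y to -Z and Z to Y, turning XX - YY + ZZ into XX - ZZ
+ YY, which acts within the token graphs. -/
theorem spectrum_HEPR (G : WGraph V) :
    spectrum ℝ G.HEPR = spectrum ℝ (G.hamiltonian termRotatedEPR) := by
  rw [← spectrum.units_conjugate (u := rotAll)]
  congr 1
  change rotAll.val * G.HEPR * rotAll.inv = _
  simp only [WGraph.HEPR, WGraph.hamiltonian, Finset.mul_sum, Finset.sum_mul, Matrix.mul_smul,
    Matrix.smul_mul, rotAll_conj_termEPR]

end Rotation

open TokenForm

/-! ### Eigenvalues of the Hamiltonians -/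

section Spectrum

variable {V : Type*} [Fintype V] [DecidableEq V]

/-- The matrix and the eigenvalue are real, so the real and imaginary parts of a complex eigenvector
both satisfy the eigenvalue equation, and one of them is nonzero. This permits working with real
forms only. -/
theorem exists_real_eigenvector {ι : Type*} [Fintype ι] [DecidableEq ι] {H : Matrix ι ι ℂ}
    {A : Matrix ι ι ℝ} (hH : ∀ i j, H i j = (A i j : ℂ)) {r : ℝ} (hr : r ∈ spectrum ℝ H) :
    ∃ x : ι → ℝ, 0 < ∑ i, x i ^ 2 ∧ ∀ i, ∑ j, A i j * x j = r * x i := by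
  rw [spectrum.mem_iff, Matrix.isUnit_iff_isUnit_det, isUnit_iff_ne_zero, not_not,
    ← Matrix.exists_mulVec_eq_zero_iff] at hr
  obtain ⟨v, hv, hHv⟩ := hr
  rw [Algebra.algebraMap_eq_smul_one, Matrix.sub_mulVec, Matrix.smul_mulVec, Matrix.one_mulVec,
    sub_eq_zero] at hHv
  have hv' : ∀ i, ∑ j, (A i j : ℂ) * v j = r * v i := by
    intro i
    have := congrFun hHv i
    simp only [Pi.smul_apply, Complex.real_smul, Matrix.mulVec, dotProduct, hH] at this
    exact this.symm
  have hpos : ∀ x : ι → ℝ, x ≠ 0 → 0 < ∑ i, x i ^ 2 := by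
    intro x hx
    obtain ⟨i, hi⟩ := Function.ne_iff.1 hx
    exact Finset.sum_pos' (fun i _ => sq_nonneg _) ⟨i, Finset.mem_univ i, by
      have : x i ≠ 0 := hi
      positivity⟩
  by_cases hre : (fun i => (v i).re) = 0
  · refine ⟨fun i => (v i).im, hpos _ fun him => hv (funext fun i => ?_), fun i => ?_⟩
    · exact Complex.ext (congrFun hre i) (congrFun him i)
    · simpa using congrArg Complex.im (hv' i)
  · refine ⟨fun i => (v i).re, hpos _ hre, fun i => ?_⟩
    simpa using congrArg Complex.re (hv' i)

theorem ActsAs.exists_form_eq {α β γ : ℝ} {h : Sym2 V → Matrix (V → Fin 2) (V → Fin 2) ℂ}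
    (hh : ActsAs α β γ h) (G : WGraph V) {r : ℝ} (hr : r ∈ spectrum ℝ (G.hamiltonian h)) :
    ∃ x : Finset V → ℝ, 0 < ∑ s, x s ^ 2 ∧
      r * ∑ s, x s ^ 2 = α * G.totalWeight * ∑ s, x s ^ 2 + form β γ G.weight x := by
  classical
  set φ : Finset V ≃ (V → Fin 2) := Equiv.ofBijective _ basisState_bijective
  set A : Matrix (Finset V) (Finset V) ℝ := Matrix.of fun s t => ∑ e, G.weight e *
    ((if t = s then α else 0) + if Cut e s then (if t = s then β else 0) +
      (if t = s ∆ e.toFinset then γ else 0) else 0) with hA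
  have hent : ∀ x y, G.hamiltonian h x y = (A (φ.symm x) (φ.symm y) : ℂ) := by
    intro x y
    obtain ⟨s, rfl⟩ := φ.surjective x
    obtain ⟨t, rfl⟩ := φ.surjective y
    rw [Equiv.symm_apply_apply, Equiv.symm_apply_apply, hA, Matrix.of_apply, WGraph.hamiltonian,
      Matrix.sum_apply, Complex.ofReal_sum]
    refine Finset.sum_subset_zero_on_sdiff (Finset.subset_univ _) (fun e he => ?_) fun e he => ?_
    · rw [G.weight_zero e (by simpa using he), zero_mul, Complex.ofReal_zero]
    · rw [Complex.ofReal_mul, Matrix.smul_apply, smul_eq_mul]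
      congr 1
      exact hh e (G.graph.not_isDiag_of_mem_edgeFinset he) s t
  obtain ⟨y, hy, hAy⟩ := exists_real_eigenvector (A := A.submatrix φ.symm φ.symm) hent hr
  refine ⟨fun s => y (φ s), ?_, ?_⟩
  · rwa [Equiv.sum_comp φ fun i => y i ^ 2]
  have hAx : ∀ s, ∑ t, A s t * y (φ t) = r * y (φ s) := by
    intro s
    rw [← hAy (φ s), ← Equiv.sum_comp φ]
    simp
  have hrow : ∀ s, r * y (φ s) ^ 2 =
      α * G.totalWeight * y (φ s) ^ 2 + formAt β γ G.weight (fun s => y (φ s)) s := by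
    intro s
    have h1 : r * y (φ s) ^ 2 = (∑ t, A s t * y (φ t)) * y (φ s) := by
      rw [hAx]
      ring
    rw [totalWeight_eq_sum, formAt, Finset.mul_sum, Finset.sum_mul, ← Finset.sum_add_distrib, h1]
    simp only [hA, Matrix.of_apply, Finset.sum_mul]
    rw [Finset.sum_comm]
    refine Finset.sum_congr rfl fun e _ => ?_
    by_cases hc : Cut e s
    · simp only [hc, if_true, mul_add, add_mul, Finset.sum_add_distrib, mul_ite, ite_mul,
        mul_zero, zero_mul, Finset.sum_ite_eq', Finset.mem_univ]
      ring
    · simp only [hc, if_false, add_zero, mul_ite, ite_mul,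
        mul_zero, zero_mul, Finset.sum_ite_eq', Finset.mem_univ, if_true]
      ring
  rw [Finset.mul_sum, Finset.sum_congr rfl fun s _ => hrow s, Finset.sum_add_distrib,
    ← Finset.mul_sum, form]

theorem ActsAs.le_of_mem_spectrum {α β γ : ℝ} {h : Sym2 V → Matrix (V → Fin 2) (V → Fin 2) ℂ}
    (hh : ActsAs α β γ h) (hb : TokenBound β γ) (hβ : β = 0 ∨ β = 1) (hγ : γ ^ 2 = 1)
    (G : WGraph V) {r : ℝ} (hr : r ∈ spectrum ℝ (G.hamiltonian h)) :
    r ≤ α * G.totalWeight + (1 + β) / 2 * (G.totalWeight + G.maxMatching) := by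
  obtain ⟨x, hx, heq⟩ := hh.exists_form_eq G hr
  have := hb.form_weight_le hβ hγ G x
  refine le_of_mul_le_mul_right ?_ hx
  linarith

theorem form_neg_right (γ : ℝ) (w : Sym2 V → ℝ) (x : Finset V → ℝ) :
    form 0 (-γ) w x = -form 0 γ w x := by
  simp only [form, formAt, ← Finset.sum_neg_distrib]
  refine Finset.sum_congr rfl fun s _ => Finset.sum_congr rfl fun e _ => ?_
  split_ifs <;> ring

end Spectrum

theorem mainTheorem4 (n : ℕ) (G : WGraph (Fin n)) :
    (ConjLMax → lamMax G.HQMC ≤ G.totalWeight + G.maxMatching) ∧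
    (ConjQMax → lamMax G.HEPR ≤ G.totalWeight + G.maxMatching) ∧
    (ConjAMin → lamMax G.HXY ≤ G.totalWeight + G.maxMatching / 2) ∧
    (ConjAMax → lamMin G.HXY ≥ -(G.maxMatching / 2)) := by
  have hW := totalWeight_nonneg G
  have hM := maxMatching_nonneg G
  refine ⟨fun h => ?_, fun h => ?_, fun h => ?_, fun h => ?_⟩
  -- Nonnegativity of the bound covers the convention that the supremum of the empty set is 0, so
  -- nonemptiness of the spectrum is not needed.
  · refine Real.sSup_le (fun r hr => ?_) (by positivity)
    have := actsAs_termQMC.le_of_mem_spectrum (tokenBound_of_conjLMax h) (Or.inr rfl)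
      (by norm_num) G hr
    linarith
  · rw [lamMax, spectrum_HEPR]
    refine Real.sSup_le (fun r hr => ?_) (by positivity)
    have := actsAs_termRotatedEPR.le_of_mem_spectrum (tokenBound_of_conjQMax h) (Or.inr rfl)
      (by norm_num) G hr
    linarith
  · refine Real.sSup_le (fun r hr => ?_) (by positivity)
    have := actsAs_termXY.le_of_mem_spectrum (tokenBound_of_conjAMin h) (Or.inl rfl)
      (by norm_num) G hr
    linarith
  · refine Real.le_sInf (fun r hr => ?_) (by linarith)
    -- For a unit vector, r is W/2 minus the form of A, and that form is at most (W + M)/2.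
    obtain ⟨x, hx, heq⟩ := actsAs_termXY.exists_form_eq G hr
    have := (tokenBound_of_conjAMax h).form_weight_le (Or.inl rfl) (by norm_num) G x
    rw [form_neg_right] at heq
    refine le_of_mul_le_mul_right ?_ hx
    linarith
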